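/- Let $1\le p\le\infty$ with conjugate exponent $p^*$, let $E$ be a real Banach space and $X$ a real Banach lattice. Operators are bounded and linear; duals $X^*,X^{**}$ of a Banach lattice carry the dual order and are Banach lattices. A Banach lattice $Z$ has the *positive metric approximation property* (PMAP) if for every $\epsilon>0$ and every compact $K\subseteq Z$ there is a positive finite rank operator $R:Z\to Z$ with $\|R\|\le 1$ and $\|Rz-z\|<\epsilon$ for all $z\in K$. Below, $F,G$ denote Banach spaces and $Y,Z$ Banach lattices. For a sequence $(v_j)_{j\ge1}$ in a Banach space $F$ let $\|(v_j)\|_p=(\sum_j\|v_j\|^p)^{1/p}$ (a supremum if $p=\infty$) and $\|(v_j)\|_p^w=\sup\{\|(\langle f,v_j\rangle)_j\|_p: f\in F^*,\ \|f\|\le1\}$. * For an operator $V:F\to Z$ let $\tilde\nu_p(V)=\inf\|(u_j^*)\|_p\,\|(x_j)\|^w_{p^*}$, the infimum being over all representations $V=\sum_j u_j^*\otimes x_j$ (convergence in operator norm) with $u_j^*\in F^*$, $0\le x_j\in Z$, $\|(u_j^*)\|_p<\infty$, $\|(x_j)\|^w_{p^*}<\infty$; $\tilde\nu_p(V)=\infty$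 if there is none. * For an operator $V:Z\to F$ let $\tilde\nu^p(V)=\inf\|(x_j^*)\|^w_{p^*}\,\|(u_j)\|_p$, the infimum being over all representations $V=\sum_j x_j^*\otimes u_j$ (convergence in operator norm) with $0\le x_j^*\in Z^*$, $u_j\in F$, $\|(x_j^*)\|^w_{p^*}<\infty$, $\|(u_j)\|_p<\infty$; $\tilde\nu^p(V)=\infty$ if there is none. * An operator $V:G\to Z$ is *latticially $p$-integral* if there is a real $C\ge0$ such that $\tilde\nu_p(BVA)\le C\|A\|\|B\|$ for all Banach spaces $F$, Banach lattices $Y$, finite rank operators $A:F\to G$ and positive finite rank operators $B:Z\to Y$; $\tilde i_p(V)$ is the infimum of all such $C$. * An operator $V:Z\to G$ is *positively $p$-integral* if there is a real $C>0$ such that $\tilde\nu^p(RVA)\le C\|R\|\|A\|$ for all Banach lattices $Y$, Banach spaces $F$, positive finite rank operators $A:Y\to Z$ and finite rank operators $R:G\to F$; $\tilde i^p(V)$ is the infimum of all such $C$. **Corollary 1.21.** Suppose that $X^{**}$ has the PMAP and let $S:E\to X$ be an operator. The following are equivalent: 1. $S$ is latticially $p$-integral; 2. $S^*:X^*\to E^*$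 is positively $p$-integral; 3. $S^{**}:E^{**}\to X^{**}$ is latticially $p$-integral. In this case $\tilde i_p(S)=\tilde i^p(S^*)=\tilde i_p(S^{**})$. -/

import Mathlib

open scoped ENNReal NNReal

universe u v

/-! ### Real Banach lattices -/

/-- A real Banach lattice: a complete normed vector lattice over `ℝ` whose norm satisfies
`|x| ≤ |y| → ‖x‖ ≤ ‖y‖`. -/
class IsBanachLattice (X : Type*) [NormedAddCommGroup X] [NormedSpace ℝ X] [Lattice X] : Prop
    extends CompleteSpace X, IsOrderedAddMonoid X, IsOrderedModule ℝ X, HasSolidNorm X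

/-! ### The dual Banach lattice

The norm dual of a Banach lattice with the order `f ≤ g ↔ ∀ x ≥ 0, f x ≤ g x` is again a Banach
lattice (Riesz–Kantorovich). -/

section Dual

variable {X : Type*} [NormedAddCommGroup X] [NormedSpace ℝ X] [Lattice X] [IsBanachLattice X]

theorem IsBanachLattice.norm_le_of_nonneg_of_le {x y : X} (hx : 0 ≤ x) (h : x ≤ y) :
    ‖x‖ ≤ ‖y‖ :=
  norm_le_norm_of_abs_le_abs (by rwa [abs_of_nonneg hx, abs_of_nonneg (hx.trans h)])

namespace StrongDual

instance instPartialOrderOfIsBanachLattice : PartialOrder (StrongDual ℝ X) where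
  le f g := ∀ x : X, 0 ≤ x → f x ≤ g x
  le_refl f x _ := le_rfl
  le_trans f g h hfg hgh x hx := (hfg x hx).trans (hgh x hx)
  le_antisymm f g hfg hgf := by
    ext x
    have hp := le_antisymm (hfg _ (posPart_nonneg x)) (hgf _ (posPart_nonneg x))
    have hn := le_antisymm (hfg _ (negPart_nonneg x)) (hgf _ (negPart_nonneg x))
    rw [← posPart_sub_negPart x, map_sub, map_sub, hp, hn]

theorem le_iff_forall_nonneg {f g : StrongDual ℝ X} :
    f ≤ g ↔ ∀ x : X, 0 ≤ x → f x ≤ g x := Iff.rfl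

/-- The value at `x ≥ 0` of the positive part of `f`, i.e. `sup {f y : 0 ≤ y ≤ x}`. -/
noncomputable def posPartAux (f : StrongDual ℝ X) (x : X) : ℝ := sSup (f '' Set.Icc 0 x)

theorem posPartAux_bddAbove (f : StrongDual ℝ X) (x : X) : BddAbove (f '' Set.Icc 0 x) := by
  refine ⟨‖f‖ * ‖x‖, ?_⟩
  rintro _ ⟨y, hy, rfl⟩
  refine (le_abs_self _).trans ((f.le_opNorm y).trans ?_)
  exact mul_le_mul_of_nonneg_left (IsBanachLattice.norm_le_of_nonneg_of_le hy.1 hy.2)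
    (norm_nonneg f)

theorem le_posPartAux (f : StrongDual ℝ X) {x y : X} (hy : 0 ≤ y) (hyx : y ≤ x) :
    f y ≤ posPartAux f x :=
  le_csSup (posPartAux_bddAbove f x) ⟨y, ⟨hy, hyx⟩, rfl⟩

theorem posPartAux_le (f : StrongDual ℝ X) {x : X} (hx : 0 ≤ x) {c : ℝ}
    (h : ∀ y, 0 ≤ y → y ≤ x → f y ≤ c) : posPartAux f x ≤ c := by
  refine csSup_le ⟨f 0, 0, ⟨le_rfl, hx⟩, rfl⟩ ?_
  rintro _ ⟨y, hy, rfl⟩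
  exact h y hy.1 hy.2

theorem posPartAux_nonneg (f : StrongDual ℝ X) {x : X} (hx : 0 ≤ x) : 0 ≤ posPartAux f x := by
  simpa using le_posPartAux f le_rfl hx

theorem posPartAux_le_norm (f : StrongDual ℝ X) {x : X} (hx : 0 ≤ x) :
    posPartAux f x ≤ ‖f‖ * ‖x‖ := by
  refine posPartAux_le f hx fun y hy hyx => ?_
  refine (le_abs_self _).trans ((f.le_opNorm y).trans ?_)
  exact mul_le_mul_of_nonneg_left (IsBanachLattice.norm_le_of_nonneg_of_le hy hyx)
    (norm_nonneg f)

theorem posPartAux_add (f : StrongDual ℝ X) {x y : X} (hx : 0 ≤ x) (hy : 0 ≤ y) :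
    posPartAux f (x + y) = posPartAux f x + posPartAux f y := by
  apply le_antisymm
  · refine posPartAux_le f (add_nonneg hx hy) fun z hz hzxy => ?_
    have h1 : f (z ⊓ x) ≤ posPartAux f x := le_posPartAux f (le_inf hz hx) inf_le_right
    have h2 : f (z - z ⊓ x) ≤ posPartAux f y := by
      refine le_posPartAux f (sub_nonneg.2 inf_le_left) ?_
      rw [sub_le_comm]
      exact le_inf (sub_le_self _ hy) (sub_le_iff_le_add.2 hzxy)
    have h3 : f z = f (z ⊓ x) + f (z - z ⊓ x) := by rw [← map_add]; congr 1; abel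
    rw [h3]
    exact add_le_add h1 h2
  · rw [← le_sub_iff_add_le]
    refine posPartAux_le f hx fun a ha hax => ?_
    rw [le_sub_comm]
    refine posPartAux_le f hy fun b hb hby => ?_
    rw [le_sub_iff_add_le, ← map_add, add_comm b a]
    exact le_posPartAux f (add_nonneg ha hb) (add_le_add hax hby)

/-- The positive part of a bounded functional on a Banach lattice. -/
noncomputable def posPartDual (f : StrongDual ℝ X) : StrongDual ℝ X :=
  let φ : X →+ ℝ := AddMonoidHom.mk' (fun x => posPartAux f x⁺ - posPartAux f x⁻) (by
    intro x y
    have key : (x + y)⁺ + (x⁻ + y⁻) = (x + y)⁻ + (x⁺ + y⁺) := by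
      have h1 := posPart_sub_negPart (x + y)
      have h2 := posPart_sub_negPart x
      have h3 := posPart_sub_negPart y
      rw [← sub_eq_zero]
      calc _ = ((x + y)⁺ - (x + y)⁻) - ((x⁺ - x⁻) + (y⁺ - y⁻)) := by abel
        _ = 0 := by rw [h1, h2, h3, sub_self]
    have key' := congrArg (posPartAux f) key
    rw [posPartAux_add f (posPart_nonneg _) (add_nonneg (negPart_nonneg _) (negPart_nonneg _)),
      posPartAux_add f (negPart_nonneg _) (negPart_nonneg _),
      posPartAux_add f (negPart_nonneg _) (add_nonneg (posPart_nonneg _) (posPart_nonneg _)),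
      posPartAux_add f (posPart_nonneg _) (posPart_nonneg _)] at key'
    linarith)
  φ.toRealLinearMap (AddMonoidHomClass.continuous_of_bound φ ‖f‖ (by
    intro x
    have hp := posPartAux_le_norm f (posPart_nonneg x)
    have hn := posPartAux_le_norm f (negPart_nonneg x)
    have hp0 := posPartAux_nonneg f (posPart_nonneg x)
    have hn0 := posPartAux_nonneg f (negPart_nonneg x)
    have hpx : ‖x⁺‖ ≤ ‖x‖ := norm_le_norm_of_abs_le_abs (by
      rw [abs_of_nonneg (posPart_nonneg x), ← posPart_add_negPart x]
      exact le_add_of_nonneg_right (negPart_nonneg x))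
    have hnx : ‖x⁻‖ ≤ ‖x‖ := norm_le_norm_of_abs_le_abs (by
      rw [abs_of_nonneg (negPart_nonneg x), ← posPart_add_negPart x]
      exact le_add_of_nonneg_left (posPart_nonneg x))
    have hp' := mul_le_mul_of_nonneg_left hpx (norm_nonneg f)
    have hn' := mul_le_mul_of_nonneg_left hnx (norm_nonneg f)
    change |posPartAux f x⁺ - posPartAux f x⁻| ≤ _
    rw [abs_le]
    constructor <;> linarith))

theorem posPartDual_apply (f : StrongDual ℝ X) {x : X} (hx : 0 ≤ x) :
    posPartDual f x = posPartAux f x := by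
  have h0 : posPartAux f 0 = 0 := by
    have := posPartAux_add f (le_refl (0 : X)) le_rfl
    rw [add_zero] at this
    linarith
  change posPartAux f x⁺ - posPartAux f x⁻ = _
  rw [posPart_of_nonneg hx, negPart_of_nonneg hx, h0, sub_zero]

instance instIsOrderedAddMonoidOfIsBanachLattice : IsOrderedAddMonoid (StrongDual ℝ X) where
  add_le_add_left f g h k x hx := by
    simpa using h x hx

theorem sup_aux_left (f g : StrongDual ℝ X) : f ≤ f + posPartDual (g - f) := by
  intro x hx
  rw [_root_.add_apply, posPartDual_apply _ hx]
  linarith [posPartAux_nonneg (g - f) hx]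

theorem sup_aux_right (f g : StrongDual ℝ X) : g ≤ f + posPartDual (g - f) := by
  intro x hx
  rw [_root_.add_apply, posPartDual_apply _ hx]
  have := le_posPartAux (g - f) hx le_rfl
  rw [_root_.sub_apply] at this
  linarith

theorem sup_aux_le {f g h : StrongDual ℝ X} (hf : f ≤ h) (hg : g ≤ h) :
    f + posPartDual (g - f) ≤ h := by
  intro x hx
  rw [_root_.add_apply, posPartDual_apply _ hx]
  have : posPartAux (g - f) x ≤ h x - f x := by
    refine posPartAux_le _ hx fun y hy hyx => ?_
    have h1 := hg y hy
    have h2 := hf (x - y) (sub_nonneg.2 hyx)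
    rw [map_sub, map_sub] at h2
    rw [_root_.sub_apply]
    linarith
  linarith

noncomputable instance instLatticeOfIsBanachLattice : Lattice (StrongDual ℝ X) where
  toPartialOrder := instPartialOrderOfIsBanachLattice
  sup f g := f + posPartDual (g - f)
  le_sup_left := sup_aux_left
  le_sup_right := sup_aux_right
  sup_le _ _ _ := sup_aux_le
  inf f g := -(-f + posPartDual (-g - -f))
  inf_le_left f g := neg_le.1 (sup_aux_left (-f) (-g))
  inf_le_right f g := neg_le.1 (sup_aux_right (-f) (-g))
  le_inf _ _ _ hg hh := le_neg.1 (sup_aux_le (neg_le_neg hg) (neg_le_neg hh))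

theorem abs_apply_le (f : StrongDual ℝ X) (x : X) : |f x| ≤ |f| |x| := by
  have hp := (abs_le'.1 (le_refl |f|)).1 _ (posPart_nonneg x)
  have hn := (abs_le'.1 (le_refl |f|)).1 _ (negPart_nonneg x)
  have hp' := (abs_le'.1 (le_refl |f|)).2 _ (posPart_nonneg x)
  have hn' := (abs_le'.1 (le_refl |f|)).2 _ (negPart_nonneg x)
  rw [_root_.neg_apply] at hp' hn'
  have h1 : f x = f x⁺ - f x⁻ := by rw [← map_sub, posPart_sub_negPart]
  have h2 : |f| |x| = |f| x⁺ + |f| x⁻ := by rw [← map_add, posPart_add_negPart]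
  rw [h1, h2, abs_le]
  constructor <;> linarith

theorem abs_apply_le_norm (f : StrongDual ℝ X) {x : X} (hx : 0 ≤ x) : |f| x ≤ ‖f‖ * ‖x‖ := by
  change (f + posPartDual (-f - f)) x ≤ _
  rw [_root_.add_apply, posPartDual_apply _ hx]
  have : posPartAux (-f - f) x ≤ ‖f‖ * ‖x‖ - f x := by
    refine posPartAux_le _ hx fun y hy hyx => ?_
    have h1 : ‖x - y - y‖ ≤ ‖x‖ := norm_le_norm_of_abs_le_abs (by
      rw [abs_of_nonneg hx, abs_le']
      constructor
      · exact (sub_le_self _ hy).trans (sub_le_self _ hy)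
      · rw [neg_sub]
        calc y - (x - y) ≤ y - 0 := sub_le_sub_left (sub_nonneg.2 hyx) y
          _ ≤ x := by rwa [sub_zero])
    have h2 := (le_abs_self _).trans ((f.le_opNorm (x - y - y)).trans
      (mul_le_mul_of_nonneg_left h1 (norm_nonneg f)))
    rw [map_sub, map_sub] at h2
    rw [_root_.sub_apply, _root_.neg_apply]
    linarith
  linarith

instance instIsBanachLattice : IsBanachLattice (StrongDual ℝ X) where
  smul_le_smul_of_nonneg_left a ha f g h x hx := mul_le_mul_of_nonneg_left (h x hx) ha
  smul_le_smul_of_nonneg_right f hf a b h x hx := mul_le_mul_of_nonneg_right h (hf x hx)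
  solid f g h := by
    refine f.opNorm_le_bound (norm_nonneg g) fun x => ?_
    calc ‖f x‖ = |f x| := rfl
      _ ≤ |f| |x| := abs_apply_le f x
      _ ≤ |g| |x| := h _ (abs_nonneg x)
      _ ≤ ‖g‖ * ‖|x|‖ := abs_apply_le_norm g (abs_nonneg x)
      _ = ‖g‖ * ‖x‖ := by rw [norm_abs_eq_norm]

end StrongDual

end Dual

/-! ### Operators -/

namespace ContinuousLinearMap

/-- A finite rank operator. -/
def IsFiniteRank {E F : Type*} [NormedAddCommGroup E] [NormedSpace ℝ E] [NormedAddCommGroup F]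
    [NormedSpace ℝ F] (T : E →L[ℝ] F) : Prop :=
  FiniteDimensional ℝ (LinearMap.range (T : E →ₗ[ℝ] F))

/-- A positive operator between Banach lattices. -/
def IsPositiveOp {X Y : Type*} [NormedAddCommGroup X] [NormedSpace ℝ X] [Lattice X]
    [NormedAddCommGroup Y] [NormedSpace ℝ Y] [Lattice Y] (T : X →L[ℝ] Y) : Prop :=
  ∀ x : X, 0 ≤ x → 0 ≤ T x

/-- The Banach space adjoint `S* : F* → E*`, `S* f = f ∘ S`. -/
noncomputable def dualAdjoint {E F : Type*} [NormedAddCommGroup E] [NormedSpace ℝ E]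
    [NormedAddCommGroup F] [NormedSpace ℝ F] (S : E →L[ℝ] F) :
    StrongDual ℝ F →L[ℝ] StrongDual ℝ E :=
  (ContinuousLinearMap.compL ℝ E F ℝ).flip S

theorem dualAdjoint_apply {E F : Type*} [NormedAddCommGroup E] [NormedSpace ℝ E]
    [NormedAddCommGroup F] [NormedSpace ℝ F] (S : E →L[ℝ] F) (f : StrongDual ℝ F) :
    S.dualAdjoint f = f.comp S := rfl

end ContinuousLinearMap

/-- The positive metric approximation property. -/
def HasPMAP (X : Type*) [NormedAddCommGroup X] [NormedSpace ℝ X] [Lattice X]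
    [IsBanachLattice X] : Prop :=
  ∀ ε : ℝ, 0 < ε → ∀ K : Set X, IsCompact K →
    ∃ R : X →L[ℝ] X, R.IsFiniteRank ∧ R.IsPositiveOp ∧ ‖R‖ ≤ 1 ∧ ∀ x ∈ K, ‖R x - x‖ < ε

/-! ### Strongly and weakly `p`-summable sequences -/

/-- The `ℓ_p` norm `(∑ ‖uₙ‖ ^ p) ^ (1 / p)` (the supremum if `p = ∞`) of a sequence, with value `∞`
if the sequence is not `p`-summable. Used for `1 ≤ p ≤ ∞`. -/
noncomputable def seqNorm {E : Type*} [NormedAddCommGroup E] (p : ℝ≥0∞) (u : ℕ → E) : ℝ≥0∞ :=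
  if p = ∞ then ⨆ n, ‖u n‖ₑ else (∑' n, ‖u n‖ₑ ^ p.toReal) ^ (1 / p.toReal)

/-- The weak `ℓ_p` norm `sup {‖(f uₙ)ₙ‖_p : f ∈ B_{E*}}`, with value `∞` if the sequence is not
weakly `p`-summable. -/
noncomputable def weakSeqNorm {E : Type*} [NormedAddCommGroup E] [NormedSpace ℝ E] (p : ℝ≥0∞)
    (u : ℕ → E) : ℝ≥0∞ :=
  ⨆ (f : StrongDual ℝ E) (_ : ‖f‖ ≤ 1), seqNorm p fun n => f (u n)

/-! ### Latticially `p`-nuclear and latticially `p`-integral operators -/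

section Lat

variable {E : Type u} [NormedAddCommGroup E] [NormedSpace ℝ E]
  {X : Type v} [NormedAddCommGroup X] [NormedSpace ℝ X] [Lattice X] [IsBanachLattice X]

/-- `S = ∑ⱼ u*ⱼ ⊗ xⱼ` (convergence in operator norm) with `(u*ⱼ) ∈ ℓ_p(E*)` and
`(xⱼ) ∈ ℓ^w_{p*}(X)` positive. -/
structure IsLatNuclearRep (p : ℝ≥0∞) (S : E →L[ℝ] X) (u : ℕ → StrongDual ℝ E) (x : ℕ → X) :
    Prop where
  summable_left : seqNorm p u < ∞
  summable_right : weakSeqNorm p.conjExponent x < ∞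
  nonneg : ∀ j, 0 ≤ x j
  hasSum : HasSum (fun j => (u j).smulRight (x j)) S

/-- The latticially `p`-nuclear norm; it is `∞` if `S` is not latticially `p`-nuclear. -/
noncomputable def latNuclearNorm (p : ℝ≥0∞) (S : E →L[ℝ] X) : ℝ≥0∞ :=
  ⨅ (u : ℕ → StrongDual ℝ E) (x : ℕ → X) (_ : IsLatNuclearRep p S u x),
    seqNorm p u * weakSeqNorm p.conjExponent x

/-- `C` is a constant as in the definition of latticially `p`-integral operators. Since
`C < ∞`, the inequality contains that `B ∘ S ∘ A` is latticially `p`-nuclear. -/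
def IsLatIntegralBound (p : ℝ≥0∞) (S : E →L[ℝ] X) (C : ℝ≥0) : Prop :=
  ∀ (F : Type u) [NormedAddCommGroup F] [NormedSpace ℝ F] [CompleteSpace F]
    (Y : Type v) [NormedAddCommGroup Y] [NormedSpace ℝ Y] [Lattice Y] [IsBanachLattice Y]
    (A : F →L[ℝ] E) (B : X →L[ℝ] Y), A.IsFiniteRank → B.IsFiniteRank → B.IsPositiveOp →
    latNuclearNorm p (B.comp (S.comp A)) ≤ C * ‖A‖ₑ * ‖B‖ₑ

/-- Latticially `p`-integral operators. -/
def IsLatIntegral (p : ℝ≥0∞) (S : E →L[ℝ] X) : Prop :=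
  ∃ C : ℝ≥0, IsLatIntegralBound p S C

/-- The latticially `p`-integral norm; it is `∞` if `S` is not latticially `p`-integral. -/
noncomputable def latIntegralNorm (p : ℝ≥0∞) (S : E →L[ℝ] X) : ℝ≥0∞ :=
  ⨅ (C : ℝ≥0) (_ : IsLatIntegralBound p S C), (C : ℝ≥0∞)

end Lat

/-! ### Positively `p`-nuclear and positively `p`-integral operators -/

section Pos

variable {X : Type v} [NormedAddCommGroup X] [NormedSpace ℝ X] [Lattice X] [IsBanachLattice X]
  {E : Type u} [NormedAddCommGroup E] [NormedSpace ℝ E]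

/-- `T = ∑ⱼ x*ⱼ ⊗ uⱼ` (convergence in operator norm) with `(x*ⱼ) ∈ ℓ^w_{p*}(X*)` positive and
`(uⱼ) ∈ ℓ_p(E)`. -/
structure IsPosNuclearRep (p : ℝ≥0∞) (T : X →L[ℝ] E) (x : ℕ → StrongDual ℝ X) (u : ℕ → E) :
    Prop where
  summable_left : weakSeqNorm p.conjExponent x < ∞
  summable_right : seqNorm p u < ∞
  nonneg : ∀ j, 0 ≤ x j
  hasSum : HasSum (fun j => (x j).smulRight (u j)) T

/-- The positively `p`-nuclear norm; it is `∞` if `T` is not positively `p`-nuclear. -/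
noncomputable def posNuclearNorm (p : ℝ≥0∞) (T : X →L[ℝ] E) : ℝ≥0∞ :=
  ⨅ (x : ℕ → StrongDual ℝ X) (u : ℕ → E) (_ : IsPosNuclearRep p T x u),
    weakSeqNorm p.conjExponent x * seqNorm p u

/-- `C` is a constant as in the definition of positively `p`-integral operators. Since
`C < ∞`, the inequality contains that `R ∘ T ∘ A` is positively `p`-nuclear. -/
def IsPosIntegralBound (p : ℝ≥0∞) (T : X →L[ℝ] E) (C : ℝ≥0) : Prop :=
  ∀ (Y : Type v) [NormedAddCommGroup Y] [NormedSpace ℝ Y] [Lattice Y] [IsBanachLattice Y]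
    (F : Type u) [NormedAddCommGroup F] [NormedSpace ℝ F] [CompleteSpace F]
    (A : Y →L[ℝ] X) (R : E →L[ℝ] F), A.IsFiniteRank → A.IsPositiveOp → R.IsFiniteRank →
    posNuclearNorm p (R.comp (T.comp A)) ≤ C * ‖R‖ₑ * ‖A‖ₑ

/-- Positively `p`-integral operators. -/
def IsPosIntegral (p : ℝ≥0∞) (T : X →L[ℝ] E) : Prop :=
  ∃ C : ℝ≥0, 0 < C ∧ IsPosIntegralBound p T C

/-- The positively `p`-integral norm; it is `∞` if `T` is not positively `p`-integral. -/
noncomputable def posIntegralNorm (p : ℝ≥0∞) (T : X →L[ℝ] E) : ℝ≥0∞ :=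
  ⨅ (C : ℝ≥0) (_ : 0 < C ∧ IsPosIntegralBound p T C), (C : ℝ≥0∞)

end Pos

/-! All three properties hold with the same constants: a bound `C` passes from `S` to `S*`, from
`S*` to `S**`, and from `S**` back to `S`, so the equivalence and the equality of norms come
together. In each implication a finite rank test pair is replaced by one acting on neighbouring
duals, up to an error that costs arbitrarily little nuclear norm.

Three tools make this possible. The nuclear norms are subadditive and bounded on an elementary
tensor by twice the product of the norms, so finite sums of small elementary tensors may be
discarded (`nucNorm_le_of_forall_exists`). Local reflexivity relative to a cone
(`exists_localReflexivity`) replaces an operator from a dual into a finite dimensional space by a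
weak* continuous one, nearly equal on finitely many vectors and of nearly the same norm; Hahn–Banach
keeps its coordinates in a prescribed cone. A positive finite rank operator is a norm limit of sums
of positive rank one operators (`exists_positive_approx`): its range is sliced like a function
approximated by step functions. Such a sum `∑ fᵢ ⊗ yᵢ` factors through `ℝ^ι` normed by `‖∑ |aᵢ|
yᵢ‖`, a Banach lattice where positivity is read off coordinates, so that local reflexivity applies
with the cone of positive functionals.

Latticial and positive nuclear norms are exchanged by transposing through a finite dimensional
space, which swaps the factors of every elementary tensor (`transposeSum_smulRight`). -/

set_option linter.unusedSectionVars false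

/-! ### Strongly and weakly `p`-summable sequences -/

section Sequences

variable {E : Type*} [NormedAddCommGroup E] {F : Type*} [NormedAddCommGroup F]

theorem seqNorm_le_mul {p : ℝ≥0∞} (hp : 1 ≤ p) {u : ℕ → E} {v : ℕ → F} {c : ℝ≥0∞}
    (h : ∀ n, ‖u n‖ₑ ≤ c * ‖v n‖ₑ) : seqNorm p u ≤ c * seqNorm p v := by
  unfold seqNorm
  split_ifs with hpt
  · refine iSup_le fun n => (h n).trans ?_
    gcongr
    exact le_iSup (fun n => ‖v n‖ₑ) n
  · have hp0 : 0 < p.toReal := ENNReal.toReal_pos (zero_lt_one.trans_le hp).ne' hpt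
    calc (∑' n, ‖u n‖ₑ ^ p.toReal) ^ (1 / p.toReal)
        ≤ (∑' n, c ^ p.toReal * ‖v n‖ₑ ^ p.toReal) ^ (1 / p.toReal) := by
          gcongr with n
          rw [← ENNReal.mul_rpow_of_nonneg _ _ hp0.le]
          exact ENNReal.rpow_le_rpow (h n) hp0.le
      _ = c * (∑' n, ‖v n‖ₑ ^ p.toReal) ^ (1 / p.toReal) := by
          rw [ENNReal.tsum_mul_left, ENNReal.mul_rpow_of_nonneg _ _ (by positivity),
            ← ENNReal.rpow_mul, mul_one_div_cancel hp0.ne', ENNReal.rpow_one]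

theorem seqNorm_single_le {p : ℝ≥0∞} (hp : 1 ≤ p) (a : E) :
    seqNorm p (fun n => if n = 0 then a else 0) ≤ ‖a‖ₑ := by
  unfold seqNorm
  split_ifs with hpt
  · refine iSup_le fun n => ?_
    dsimp only
    split_ifs <;> simp
  · have hp0 : 0 < p.toReal := ENNReal.toReal_pos (zero_lt_one.trans_le hp).ne' hpt
    rw [tsum_eq_single 0 (fun n hn => by simp [hn, hp0])]
    simp [← ENNReal.rpow_mul, mul_inv_cancel₀ hp0.ne']

/-- The sequence `u 0, v 0, u 1, v 1, …`. -/
def interleave {α : Type*} (u v : ℕ → α) (n : ℕ) : α := if Even n then u (n / 2) else v (n / 2)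

@[simp]
theorem interleave_even {α : Type*} (u v : ℕ → α) (n : ℕ) : interleave u v (2 * n) = u n := by
  simp [interleave]

@[simp]
theorem interleave_odd {α : Type*} (u v : ℕ → α) (n : ℕ) : interleave u v (2 * n + 1) = v n := by
  have : (2 * n + 1) / 2 = n := by omega
  simp [interleave, this]

theorem forall_interleave {α : Type*} {u v : ℕ → α} {P : α → Prop} (hu : ∀ n, P (u n))
    (hv : ∀ n, P (v n)) (n : ℕ) : P (interleave u v n) := by
  unfold interleave
  split_ifs
  exacts [hu _, hv _]

/-- The `p`-th powers of the norms add. Bounds are written as `c ^ (1 / p.toReal)` to cover `p = ∞`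
as well: there `1 / p.toReal = 0`, and every bound reads `≤ 1`. -/
theorem seqNorm_interleave_le {p : ℝ≥0∞} (hp : 1 ≤ p) {u v : ℕ → E} {c d : ℝ≥0∞}
    (hu : seqNorm p u ≤ c ^ (1 / p.toReal)) (hv : seqNorm p v ≤ d ^ (1 / p.toReal)) :
    seqNorm p (interleave u v) ≤ (c + d) ^ (1 / p.toReal) := by
  unfold seqNorm at *
  split_ifs at * with hpt
  · subst hpt
    simp only [ENNReal.toReal_top, div_zero, ENNReal.rpow_zero, iSup_le_iff] at *
    exact forall_interleave (P := fun x => ‖x‖ₑ ≤ 1) hu hv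
  · have hp0 : 0 < p.toReal := ENNReal.toReal_pos (zero_lt_one.trans_le hp).ne' hpt
    have h1 : 0 < 1 / p.toReal := by positivity
    rw [ENNReal.rpow_le_rpow_iff h1] at *
    rw [← tsum_even_add_odd ENNReal.summable ENNReal.summable]
    simpa using add_le_add hu hv

variable [NormedSpace ℝ E] [NormedSpace ℝ F]

theorem seqNorm_apply_le {p : ℝ≥0∞} (hp : 1 ≤ p) (f : StrongDual ℝ E) (x : ℕ → E) :
    seqNorm p (fun n => f (x n)) ≤ ‖f‖ₑ * weakSeqNorm p x := by
  by_cases hf : ‖f‖ = 0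
  · have : f = 0 := norm_eq_zero.1 hf
    subst this
    refine (seqNorm_le_mul hp (v := x) (c := 0) (by simp)).trans ?_
    simp
  · have h1 : ‖(‖f‖⁻¹ • f)‖ ≤ 1 := by
      rw [norm_smul, norm_inv, norm_norm, inv_mul_cancel₀ hf]
    refine (seqNorm_le_mul hp (v := fun n => (‖f‖⁻¹ • f) (x n)) (c := ‖f‖ₑ) fun n => ?_).trans ?_
    · rw [← enorm_norm f, ← enorm_mul, _root_.smul_apply, smul_eq_mul, mul_inv_cancel_left₀ hf]
    · gcongr
      exact le_iSup₂ (f := fun (f : StrongDual ℝ E) (_ : ‖f‖ ≤ 1) => seqNorm p fun n => f (x n))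
        _ h1

theorem weakSeqNorm_le {p : ℝ≥0∞} {x : ℕ → E} {c : ℝ≥0∞}
    (h : ∀ f : StrongDual ℝ E, ‖f‖ ≤ 1 → seqNorm p (fun n => f (x n)) ≤ c) :
    weakSeqNorm p x ≤ c := iSup₂_le h

theorem seqNorm_apply_le_weakSeqNorm {p : ℝ≥0∞} {x : ℕ → E} {f : StrongDual ℝ E}
    (hf : ‖f‖ ≤ 1) : seqNorm p (fun n => f (x n)) ≤ weakSeqNorm p x :=
  le_iSup₂ (f := fun (f : StrongDual ℝ E) (_ : ‖f‖ ≤ 1) => seqNorm p fun n => f (x n)) f hf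

theorem enorm_le_one_of_norm_le_one {a : E} (h : ‖a‖ ≤ 1) : ‖a‖ₑ ≤ 1 := by
  rw [← ofReal_norm]
  exact ENNReal.ofReal_le_one.2 h

theorem weakSeqNorm_map_le {p : ℝ≥0∞} (hp : 1 ≤ p) (Q : E →L[ℝ] F) (x : ℕ → E) :
    weakSeqNorm p (fun n => Q (x n)) ≤ ‖Q‖ₑ * weakSeqNorm p x := by
  refine weakSeqNorm_le fun f hf => ?_
  refine (seqNorm_apply_le hp (f.comp Q) x).trans ?_
  gcongr
  rw [← ofReal_norm, ← ofReal_norm]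
  refine ENNReal.ofReal_le_ofReal ((f.opNorm_comp_le Q).trans ?_)
  exact mul_le_of_le_one_left (norm_nonneg _) hf

theorem seqNorm_map_le {p : ℝ≥0∞} (hp : 1 ≤ p) (Q : E →L[ℝ] F) (x : ℕ → E) :
    seqNorm p (fun n => Q (x n)) ≤ ‖Q‖ₑ * seqNorm p x :=
  seqNorm_le_mul hp fun n => Q.le_opENorm (x n)

theorem weakSeqNorm_smul_le {p : ℝ≥0∞} (hp : 1 ≤ p) (t : ℝ) (x : ℕ → E) :
    weakSeqNorm p (fun n => t • x n) ≤ ‖t‖ₑ * weakSeqNorm p x := by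
  refine weakSeqNorm_le fun f hf => ?_
  refine (seqNorm_le_mul hp (v := fun n => f (x n)) (c := ‖t‖ₑ) fun n => ?_).trans ?_
  · rw [map_smul, enorm_smul]
  · gcongr
    exact seqNorm_apply_le_weakSeqNorm hf

theorem seqNorm_smul_le {p : ℝ≥0∞} (hp : 1 ≤ p) (t : ℝ) (x : ℕ → E) :
    seqNorm p (fun n => t • x n) ≤ ‖t‖ₑ * seqNorm p x :=
  seqNorm_le_mul hp fun n => (enorm_smul t (x n)).le

theorem weakSeqNorm_interleave_le {p : ℝ≥0∞} (hp : 1 ≤ p) {u v : ℕ → E} {c d : ℝ≥0∞}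
    (hu : weakSeqNorm p u ≤ c ^ (1 / p.toReal)) (hv : weakSeqNorm p v ≤ d ^ (1 / p.toReal)) :
    weakSeqNorm p (interleave u v) ≤ (c + d) ^ (1 / p.toReal) := by
  refine weakSeqNorm_le fun f hf => ?_
  have : (fun n => f (interleave u v n)) = interleave (fun n => f (u n)) fun n => f (v n) := by
    ext n
    unfold interleave
    split_ifs <;> rfl
  rw [this]
  exact seqNorm_interleave_le hp ((seqNorm_apply_le_weakSeqNorm hf).trans hu)
    ((seqNorm_apply_le_weakSeqNorm hf).trans hv)

theorem weakSeqNorm_single_le {p : ℝ≥0∞} (hp : 1 ≤ p) (a : E) :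
    weakSeqNorm p (fun n => if n = 0 then a else 0) ≤ ‖a‖ₑ := by
  refine weakSeqNorm_le fun f hf => ?_
  have : (fun n => f (if n = 0 then a else 0)) = fun n : ℕ => if n = 0 then f a else 0 := by
    ext n
    split_ifs <;> simp
  rw [this]
  refine (seqNorm_single_le hp (f a)).trans ((f.le_opENorm a).trans ?_)
  exact mul_le_of_le_one_left (by positivity) (enorm_le_one_of_norm_le_one hf)

end Sequences

/-! ### Nuclear norms with respect to a bilinear map -/

section NucNorm

variable {U : Type*} [NormedAddCommGroup U] [NormedSpace ℝ U]
  {Z : Type*} [NormedAddCommGroup Z] [NormedSpace ℝ Z] [Lattice Z] [IsBanachLattice Z]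
  {O : Type*} [NormedAddCommGroup O] [NormedSpace ℝ O]

/-- `V = ∑ⱼ β (uⱼ) (xⱼ)` with `(uⱼ)` strongly `p`-summable and `(xⱼ)` positive and weakly
`p*`-summable. -/
structure IsNucRep (β : U →L[ℝ] Z →L[ℝ] O) (p : ℝ≥0∞) (V : O) (u : ℕ → U) (x : ℕ → Z) :
    Prop where
  left : seqNorm p u < ∞
  right : weakSeqNorm p.conjExponent x < ∞
  nonneg : ∀ j, 0 ≤ x j
  hasSum : HasSum (fun j => β (u j) (x j)) V

/-- The nuclear norm of `V` with respect to the bilinear map `β`. -/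
noncomputable def nucNorm (β : U →L[ℝ] Z →L[ℝ] O) (p : ℝ≥0∞) (V : O) : ℝ≥0∞ :=
  ⨅ (u : ℕ → U) (x : ℕ → Z) (_ : IsNucRep β p V u x), seqNorm p u * weakSeqNorm p.conjExponent x

variable {β : U →L[ℝ] Z →L[ℝ] O} {p : ℝ≥0∞} {V V' : O}

theorem nucNorm_le {u : ℕ → U} {x : ℕ → Z} (h : IsNucRep β p V u x) :
    nucNorm β p V ≤ seqNorm p u * weakSeqNorm p.conjExponent x :=
  iInf_le_of_le u (iInf_le_of_le x (iInf_le _ h))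

theorem exists_isNucRep_of_nucNorm_lt {c : ℝ≥0∞} (h : nucNorm β p V < c) :
    ∃ u x, IsNucRep β p V u x ∧ seqNorm p u * weakSeqNorm p.conjExponent x < c := by
  simpa only [nucNorm, iInf_lt_iff, exists_prop] using h

theorem one_le_conjExponent (p : ℝ≥0∞) : 1 ≤ p.conjExponent := le_self_add

theorem one_div_toReal_add_conjExponent (hp : 1 ≤ p) :
    1 / p.toReal + 1 / p.conjExponent.toReal = 1 := by
  have h := ENNReal.HolderConjugate.conjExponent hp
  have h' := congrArg ENNReal.toReal h.inv_add_inv_eq_inv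
  have hp0 : p ≠ 0 := (zero_lt_one.trans_le hp).ne'
  have hq0 : p.conjExponent ≠ 0 := (zero_lt_one.trans_le (one_le_conjExponent p)).ne'
  rw [ENNReal.toReal_add (by simpa using hp0) (by simpa using hq0)] at h'
  simpa using h'

/-- Replacing `u, x` by `t • u, t⁻¹ • x` changes no tensor, so a product of norms below `c = c ^
(1/p) * c ^ (1/p*)` can be distributed between the two factors as desired. -/
theorem exists_balanced_rep_of_nucNorm_lt (hp : 1 ≤ p) {c : ℝ≥0∞} (hc : c ≠ ∞)
    (h : nucNorm β p V < c) :
    ∃ (u : ℕ → U) (x : ℕ → Z), (∀ j, 0 ≤ x j) ∧ HasSum (fun j => β (u j) (x j)) V ∧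
      seqNorm p u ≤ c ^ (1 / p.toReal) ∧
      weakSeqNorm p.conjExponent x ≤ c ^ (1 / p.conjExponent.toReal) := by
  obtain ⟨u, x, hr, hlt⟩ := exists_isNucRep_of_nucNorm_lt h
  have hc0 : c ≠ 0 := (zero_le.trans_lt h).ne'
  have hq := one_le_conjExponent p
  have hpq : c ^ (1 / p.toReal) * c ^ (1 / p.conjExponent.toReal) = c := by
    rw [← ENNReal.rpow_add _ _ hc0 hc, one_div_toReal_add_conjExponent hp, ENNReal.rpow_one]
  have hA := ENNReal.rpow_ne_top_of_ne_zero (y := 1 / p.toReal) hc0 hc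
  have hA0 : c ^ (1 / p.toReal) ≠ 0 := (ENNReal.rpow_pos (pos_iff_ne_zero.2 hc0) hc).ne'
  have hB := ENNReal.rpow_ne_top_of_ne_zero (y := 1 / p.conjExponent.toReal) hc0 hc
  have hB0 : c ^ (1 / p.conjExponent.toReal) ≠ 0 :=
    (ENNReal.rpow_pos (pos_iff_ne_zero.2 hc0) hc).ne'
  have hl := hr.left
  have hrt := hr.right
  generalize hAd : c ^ (1 / p.toReal) = A at *
  generalize hBd : c ^ (1 / p.conjExponent.toReal) = B at *
  generalize had : seqNorm p u = a at *
  generalize hbd : weakSeqNorm p.conjExponent x = b at *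
  -- The scale is `A / a`. If `a = 0`, any `t ≥ b / B` works, and the summand `1` keeps it nonzero.
  obtain ⟨t, ht0, ht, hta, htb⟩ : ∃ t : ℝ≥0∞, t ≠ 0 ∧ t ≠ ∞ ∧ t * a ≤ A ∧ t⁻¹ * b ≤ B := by
    by_cases ha : a = 0
    · refine ⟨b / B + 1, by simp, ?_, by simp [ha], ?_⟩
      · exact ENNReal.add_ne_top.2 ⟨ENNReal.div_ne_top hrt.ne hB0, by simp⟩
      · rw [mul_comm, ← div_eq_mul_inv, ENNReal.div_le_iff (by simp)
          (ENNReal.add_ne_top.2 ⟨ENNReal.div_ne_top hrt.ne hB0, by simp⟩), mul_add,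
          ENNReal.mul_div_cancel hB0 hB]
        exact le_self_add
    · refine ⟨A / a, ENNReal.div_ne_zero.2 ⟨hA0, hl.ne⟩, ENNReal.div_ne_top hA ha, ?_, ?_⟩
      · rw [ENNReal.div_mul_cancel ha hl.ne]
      · rw [ENNReal.inv_div (Or.inl hl.ne) (Or.inl ha), mul_comm, ← mul_div_assoc,
          ENNReal.div_le_iff hA0 hA, mul_comm B, hpq, mul_comm]
        exact hlt.le
  lift t to ℝ≥0 using ht
  have ht0' : t ≠ 0 := by simpa using ht0
  have e1 : ‖(t : ℝ)‖ₑ = t := by rw [Real.enorm_eq_ofReal t.coe_nonneg, ENNReal.ofReal_coe_nnreal]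
  have e2 : ‖(t : ℝ)⁻¹‖ₑ = (t : ℝ≥0∞)⁻¹ := by
    rw [← NNReal.coe_inv, Real.enorm_eq_ofReal (NNReal.coe_nonneg _), ENNReal.ofReal_coe_nnreal,
      ENNReal.coe_inv ht0']
  refine ⟨fun n => (t : ℝ) • u n, fun n => (t : ℝ)⁻¹ • x n,
    fun j => smul_nonneg (by positivity) (hr.nonneg j), ?_, ?_, ?_⟩
  · convert hr.hasSum using 2 with j
    simp [smul_smul, ht0']
  · refine (seqNorm_smul_le hp _ u).trans ?_
    rwa [e1, had]
  · refine (weakSeqNorm_smul_le hq _ x).trans ?_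
    rwa [e2, hbd]

/-- Balanced representations for `c` and `d` interleave to one with factors at most `(c + d) ^
(1/p)` and `(c + d) ^ (1/p*)`, whose product is `c + d`. Balancing is what gives the triangle
inequality with constant one. -/
theorem nucNorm_add_le (hp : 1 ≤ p) : nucNorm β p (V + V') ≤ nucNorm β p V + nucNorm β p V' := by
  by_cases h1 : nucNorm β p V = ∞
  · simp [h1]
  by_cases h2 : nucNorm β p V' = ∞
  · simp [h2]
  refine ENNReal.le_of_forall_pos_le_add fun ε hε _ => ?_
  have hε' : (ε / 2 : ℝ≥0∞) ≠ 0 := by simpa using hε.ne'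
  have hεt : (ε / 2 : ℝ≥0∞) ≠ ∞ := ENNReal.div_ne_top (by simp) (by simp)
  obtain ⟨u, x, hx, hs, hu, hw⟩ := exists_balanced_rep_of_nucNorm_lt hp
    (ENNReal.add_ne_top.2 ⟨h1, hεt⟩) (ENNReal.lt_add_right h1 hε')
  obtain ⟨u', x', hx', hs', hu', hw'⟩ := exists_balanced_rep_of_nucNorm_lt hp
    (ENNReal.add_ne_top.2 ⟨h2, hεt⟩) (ENNReal.lt_add_right h2 hε')
  have hq := one_le_conjExponent p
  have H1 := seqNorm_interleave_le hp hu hu'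
  have H2 := weakSeqNorm_interleave_le hq hw hw'
  have hc : nucNorm β p V + ε / 2 + (nucNorm β p V' + ε / 2) =
      nucNorm β p V + nucNorm β p V' + ε := by
    conv_rhs => rw [← ENNReal.add_halves (ε : ℝ≥0∞)]
    ring
  rw [hc] at H1 H2
  set c := nucNorm β p V + nucNorm β p V' + ε
  have hct : c ≠ ∞ := by simp [c, h1, h2]
  have hc0 : c ≠ 0 := by simp [c, hε.ne']
  have hrep : IsNucRep β p (V + V') (interleave u u') (interleave x x') := by
    refine ⟨H1.trans_lt ?_, H2.trans_lt ?_, forall_interleave (P := fun z : Z => 0 ≤ z) hx hx', ?_⟩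
    · exact (ENNReal.rpow_ne_top_of_ne_zero hc0 hct).lt_top
    · exact (ENNReal.rpow_ne_top_of_ne_zero hc0 hct).lt_top
    · exact HasSum.even_add_odd (by simpa using hs) (by simpa using hs')
  refine (nucNorm_le hrep).trans ((mul_le_mul' H1 H2).trans_eq ?_)
  rw [← ENNReal.rpow_add _ _ hc0 hct, one_div_toReal_add_conjExponent hp, ENNReal.rpow_one]

theorem nucNorm_apply_le_of_nonneg (hp : 1 ≤ p) (a : U) {z : Z} (hz : 0 ≤ z) :
    nucNorm β p (β a z) ≤ ‖a‖ₑ * ‖z‖ₑ := by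
  have h1 := seqNorm_single_le hp a
  have h2 := weakSeqNorm_single_le (one_le_conjExponent p) z
  refine (nucNorm_le (u := fun n => if n = 0 then a else 0) (x := fun n => if n = 0 then z else 0)
    ⟨h1.trans_lt (by simp), h2.trans_lt (by simp), fun j => ?_, ?_⟩).trans (mul_le_mul' h1 h2)
  · split_ifs
    exacts [hz, le_rfl]
  · convert hasSum_ite_eq (0 : ℕ) (β a z) using 2 with n
    split_ifs <;> simp

theorem nucNorm_zero (hp : 1 ≤ p) : nucNorm β p 0 = 0 := by
  simpa using nucNorm_apply_le_of_nonneg (β := β) hp 0 (le_refl (0 : Z))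

theorem norm_posPart_le (z : Z) : ‖z⁺‖ ≤ ‖z‖ := norm_le_norm_of_abs_le_abs (by
  rw [abs_of_nonneg (posPart_nonneg z), ← posPart_add_negPart z]
  exact le_add_of_nonneg_right (negPart_nonneg z))

theorem norm_negPart_le (z : Z) : ‖z⁻‖ ≤ ‖z‖ := norm_le_norm_of_abs_le_abs (by
  rw [abs_of_nonneg (negPart_nonneg z), ← posPart_add_negPart z]
  exact le_add_of_nonneg_left (posPart_nonneg z))

/-- The second factor must be positive, so `z` is split as `z⁺ - z⁻` and the sign moved to `a`; this
costs the factor 2. -/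
theorem nucNorm_apply_le (hp : 1 ≤ p) (a : U) (z : Z) :
    nucNorm β p (β a z) ≤ 2 * (‖a‖ₑ * ‖z‖ₑ) := by
  have h : β a z = β a z⁺ + β (-a) z⁻ := by
    conv_lhs => rw [← posPart_sub_negPart z]
    simp [sub_eq_add_neg]
  rw [h, two_mul]
  refine (nucNorm_add_le hp).trans (add_le_add ?_ ?_)
  · refine (nucNorm_apply_le_of_nonneg hp a (posPart_nonneg z)).trans ?_
    gcongr
    exact enorm_le_iff_norm_le.2 (norm_posPart_le z)
  · refine (nucNorm_apply_le_of_nonneg hp (-a) (negPart_nonneg z)).trans ?_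
    rw [enorm_neg]
    gcongr
    exact enorm_le_iff_norm_le.2 (norm_negPart_le z)

theorem nucNorm_sum_apply_le (hp : 1 ≤ p) {κ : Type*} (s : Finset κ) (a : κ → U) (z : κ → Z) :
    nucNorm β p (∑ k ∈ s, β (a k) (z k)) ≤ ∑ k ∈ s, 2 * (‖a k‖ₑ * ‖z k‖ₑ) := by
  classical
  induction s using Finset.induction_on with
  | empty => simp [nucNorm_zero hp]
  | insert k s hk ih =>
    rw [Finset.sum_insert hk, Finset.sum_insert hk]
    exact (nucNorm_add_le hp).trans (add_le_add (nucNorm_apply_le hp _ _) ih)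

/-- If `V = V' + ∑ β (aₖ) (zₖ)`, with arbitrarily small sums and `V'` of norm at most almost `c`,
then `V` has norm at most `c`. -/
theorem nucNorm_le_of_forall_exists (hp : 1 ≤ p) {c : ℝ≥0∞}
    (h : ∀ ε : ℝ≥0, 0 < ε → ∃ V' : O, nucNorm β p V' ≤ c + ε ∧
      ∃ (n : ℕ) (a : Fin n → U) (z : Fin n → Z), V = V' + ∑ k, β (a k) (z k) ∧
        ∑ k, ‖a k‖ * ‖z k‖ ≤ ε) :
    nucNorm β p V ≤ c := by
  refine ENNReal.le_of_forall_pos_le_add fun ε hε _ => ?_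
  -- One third of `ε` is spent on `V'`, and the error tensors count twice.
  obtain ⟨V', hV', n, a, z, hV, hs⟩ := h (ε / 3) (by positivity)
  rw [hV]
  refine (nucNorm_add_le hp).trans
    ((add_le_add hV' (nucNorm_sum_apply_le hp _ a z)).trans ?_)
  have h2 : ∑ k, 2 * (‖a k‖ₑ * ‖z k‖ₑ) ≤ 2 * ((ε / 3 : ℝ≥0) : ℝ≥0∞) := by
    rw [← Finset.mul_sum]
    gcongr
    calc ∑ k, ‖a k‖ₑ * ‖z k‖ₑ = ENNReal.ofReal (∑ k, ‖a k‖ * ‖z k‖) := by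
          rw [ENNReal.ofReal_sum_of_nonneg fun i _ => by positivity]
          simp [ENNReal.ofReal_mul]
      _ ≤ ENNReal.ofReal ((ε / 3 : ℝ≥0) : ℝ) := ENNReal.ofReal_le_ofReal hs
      _ = _ := ENNReal.ofReal_coe_nnreal
  calc c + ((ε / 3 : ℝ≥0) : ℝ≥0∞) + ∑ k, 2 * (‖a k‖ₑ * ‖z k‖ₑ)
      ≤ c + ((ε / 3 : ℝ≥0) : ℝ≥0∞) + 2 * ((ε / 3 : ℝ≥0) : ℝ≥0∞) := by gcongr
    _ = c + ((ε / 3 + 2 * (ε / 3) : ℝ≥0) : ℝ≥0∞) := by push_cast; ring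
    _ = c + ε := by
        congr 2
        ext
        push_cast
        ring

end NucNorm

/-! ### Both nuclear norms as instances of `nucNorm` -/

section Identification

variable {E : Type u} [NormedAddCommGroup E] [NormedSpace ℝ E]
  {X : Type v} [NormedAddCommGroup X] [NormedSpace ℝ X] [Lattice X] [IsBanachLattice X]

theorem isLatNuclearRep_iff {p : ℝ≥0∞} {S : E →L[ℝ] X} {u : ℕ → StrongDual ℝ E} {x : ℕ → X} :
    IsLatNuclearRep p S u x ↔ IsNucRep (ContinuousLinearMap.smulRightL ℝ E X) p S u x :=
  ⟨fun h => ⟨h.1, h.2, h.3, h.4⟩, fun h => ⟨h.1, h.2, h.3, h.4⟩⟩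

theorem latNuclearNorm_eq (p : ℝ≥0∞) (S : E →L[ℝ] X) :
    latNuclearNorm p S = nucNorm (ContinuousLinearMap.smulRightL ℝ E X) p S := by
  simp only [latNuclearNorm, nucNorm, isLatNuclearRep_iff]

theorem isPosNuclearRep_iff {p : ℝ≥0∞} {T : X →L[ℝ] E} {x : ℕ → StrongDual ℝ X} {u : ℕ → E} :
    IsPosNuclearRep p T x u ↔ IsNucRep (ContinuousLinearMap.smulRightL ℝ X E).flip p T u x :=
  ⟨fun h => ⟨h.2, h.1, h.3, h.4⟩, fun h => ⟨h.2, h.1, h.3, h.4⟩⟩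

theorem posNuclearNorm_eq (p : ℝ≥0∞) (T : X →L[ℝ] E) :
    posNuclearNorm p T = nucNorm (ContinuousLinearMap.smulRightL ℝ X E).flip p T := by
  simp only [posNuclearNorm, nucNorm, isPosNuclearRep_iff, mul_comm]
  exact iInf_comm

end Identification

/-! ### Finite rank operators -/

section FiniteRank

variable {E F G : Type*} [NormedAddCommGroup E] [NormedSpace ℝ E]
  [NormedAddCommGroup F] [NormedSpace ℝ F] [NormedAddCommGroup G] [NormedSpace ℝ G]

theorem ContinuousLinearMap.IsFiniteRank.exists_eq_sum {T : E →L[ℝ] F} (hT : T.IsFiniteRank) :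
    ∃ (n : ℕ) (u : Fin n → StrongDual ℝ E) (v : Fin n → F), T = ∑ k, (u k).smulRight (v k) := by
  have : FiniteDimensional ℝ (LinearMap.range (T : E →ₗ[ℝ] F)) := hT
  let b := Module.finBasis ℝ (LinearMap.range (T : E →ₗ[ℝ] F))
  let T₁ : E →L[ℝ] LinearMap.range (T : E →ₗ[ℝ] F) :=
    T.codRestrict _ fun x => LinearMap.mem_range_self (T : E →ₗ[ℝ] F) x
  refine ⟨_, fun k => (b.coord k).toContinuousLinearMap.comp T₁, fun k => (b k : F), ?_⟩
  ext x
  have h := congrArg (Subtype.val) (b.sum_repr (T₁ x))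
  simp only [Submodule.coe_sum, Submodule.coe_smul] at h
  simp only [_root_.sum_apply, ContinuousLinearMap.smulRight_apply]
  exact h.symm

theorem ContinuousLinearMap.isFiniteRank_sum {κ : Type*} [Fintype κ] (u : κ → StrongDual ℝ E)
    (v : κ → F) : (∑ k, (u k).smulRight (v k)).IsFiniteRank := by
  have : FiniteDimensional ℝ (Submodule.span ℝ (Set.range v)) :=
    FiniteDimensional.span_of_finite ℝ (Set.finite_range v)
  refine Submodule.finiteDimensional_of_le (S₂ := Submodule.span ℝ (Set.range v)) ?_
  rintro _ ⟨x, rfl⟩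
  simp only [ContinuousLinearMap.coe_coe, _root_.sum_apply,
    ContinuousLinearMap.smulRight_apply]
  exact Submodule.sum_mem _ fun k _ =>
    Submodule.smul_mem _ _ (Submodule.subset_span (Set.mem_range_self k))

theorem ContinuousLinearMap.IsFiniteRank.comp_left {T : E →L[ℝ] F} (hT : T.IsFiniteRank)
    (S : F →L[ℝ] G) : (S.comp T).IsFiniteRank := by
  obtain ⟨n, u, v, rfl⟩ := hT.exists_eq_sum
  convert isFiniteRank_sum u fun k => S (v k) using 1
  ext x
  simp

/-- For an operator `A : E → F*`, the map `A.flip : F → E*` is the adjoint restricted to the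
predual; it takes the place of the adjoint in the test pairs below. -/
theorem ContinuousLinearMap.IsFiniteRank.flip {T : E →L[ℝ] F →L[ℝ] ℝ} (hT : T.IsFiniteRank) :
    T.flip.IsFiniteRank := by
  obtain ⟨n, u, v, rfl⟩ := hT.exists_eq_sum
  convert isFiniteRank_sum v u using 1
  ext x y
  simp [mul_comm]

theorem ContinuousLinearMap.isFiniteRank_of_finiteDimensional_left [FiniteDimensional ℝ E]
    (T : E →L[ℝ] F) : T.IsFiniteRank :=
  inferInstanceAs (FiniteDimensional ℝ (LinearMap.range (T : E →ₗ[ℝ] F)))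

theorem ContinuousLinearMap.isFiniteRank_of_finiteDimensional_right [FiniteDimensional ℝ F]
    (T : E →L[ℝ] F) : T.IsFiniteRank :=
  inferInstanceAs (FiniteDimensional ℝ (LinearMap.range (T : E →ₗ[ℝ] F)))

end FiniteRank

/-! ### Local reflexivity relative to a cone -/

section LocalReflexivity

variable {Z : Type*} [NormedAddCommGroup Z] [NormedSpace ℝ Z]
  {G : Type*} [NormedAddCommGroup G] [NormedSpace ℝ G] [FiniteDimensional ℝ G]
  {ι : Type*} [Fintype ι]

/-- The operator `G* → Z`, `ξ ↦ ∑ ξ (cᵢ) gᵢ`. -/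
noncomputable def evalSum (c : ι → G) (g : ι → Z) : StrongDual ℝ G →L[ℝ] Z :=
  ∑ i, (ContinuousLinearMap.apply ℝ ℝ (c i)).smulRight (g i)

@[simp]
theorem evalSum_apply (c : ι → G) (g : ι → Z) (ξ : StrongDual ℝ G) :
    evalSum c g ξ = ∑ i, ξ (c i) • g i := by
  simp [evalSum]

/-- The slack `s < r` compensates for the norm of `ψ` possibly not being attained. -/
theorem exists_norm_lt_le_apply {ψ : StrongDual ℝ Z} {r s : ℝ} (hs : 0 ≤ s) (hrs : s < r) :
    ∃ v : Z, ‖v‖ < r ∧ s * ‖ψ‖ ≤ ψ v := by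
  have hr : 0 < r := hs.trans_lt hrs
  by_cases hψ : ‖ψ‖ = 0
  · exact ⟨0, by simpa using hr, by simp [hψ]⟩
  · have hpos : 0 < ‖ψ‖ := lt_of_le_of_ne (norm_nonneg _) (Ne.symm hψ)
    obtain ⟨x, hx, hlt⟩ := ψ.exists_lt_apply_of_lt_opNorm
      (r := s / r * ‖ψ‖) (by
        have : s / r < 1 := (div_lt_one hr).2 hrs
        nlinarith)
    have key : s * ‖ψ‖ ≤ r * ‖ψ x‖ := by
      have := mul_le_mul_of_nonneg_left hlt.le hr.le
      calc s * ‖ψ‖ = r * (s / r * ‖ψ‖) := by field_simp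
        _ ≤ _ := this
    rcases le_total 0 (ψ x) with h | h
    · refine ⟨r • x, ?_, ?_⟩
      · rw [norm_smul, Real.norm_of_nonneg hr.le]
        nlinarith
      · rw [map_smul, smul_eq_mul]
        rwa [Real.norm_of_nonneg h] at key
    · refine ⟨-(r • x), ?_, ?_⟩
      · rw [norm_neg, norm_smul, Real.norm_of_nonneg hr.le]
        nlinarith
      · rw [map_neg, map_smul, smul_eq_mul]
        rw [Real.norm_of_nonpos h] at key
        linarith

theorem dual_eq_sum_coord (c : Module.Basis ι ℝ G) (ξ : StrongDual ℝ G) (y : G) :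
    ξ y = ∑ i, ξ (c i) * c.coord i y := by
  conv_lhs => rw [← c.sum_repr y]
  simp only [map_sum, map_smul, smul_eq_mul, Module.Basis.coord_apply, mul_comm]

theorem exists_eq_sum_of_pi_prod {K A : Type*} [Fintype K] [Fintype A]
    (f : StrongDual ℝ ((K → Z) × (A → ℝ))) :
    ∃ (ψ : K → StrongDual ℝ Z) (lam : A → ℝ), ∀ (z : K → Z) (w : A → ℝ),
      f (z, w) = ∑ k, ψ k (z k) + ∑ a, w a * lam a := by
  classical
  refine ⟨fun k => f.comp
    ((ContinuousLinearMap.inl ℝ _ _).comp (ContinuousLinearMap.single ℝ (fun _ : K => Z) k)),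
    fun a => f (0, Pi.single a 1), fun z w => ?_⟩
  have h1 : (z, w) = ContinuousLinearMap.inl ℝ (K → Z) (A → ℝ) z +
      ContinuousLinearMap.inr ℝ (K → Z) (A → ℝ) w := by simp
  rw [h1, map_add]
  congr 1
  · conv_lhs => rw [← Finset.univ_sum_single z]
    rw [map_sum, map_sum]
    rfl
  · conv_lhs => rw [pi_eq_sum_univ' w]
    rw [map_sum, map_sum]
    refine Finset.sum_congr rfl fun a _ => ?_
    rw [map_smul, map_smul, smul_eq_mul]
    rfl

theorem exists_separating_pi_prod {K A : Type*} [Fintype K] [Fintype A]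
    {s t : Set ((K → Z) × (A → ℝ))} (hs : Convex ℝ s) (ho : IsOpen s) (ht : Convex ℝ t)
    (hst : Disjoint s t) :
    ∃ (ψ : K → StrongDual ℝ Z) (lam : A → ℝ) (u : ℝ),
      (∀ z w, (z, w) ∈ s → ∑ k, ψ k (z k) + ∑ a, w a * lam a < u) ∧
      ∀ z w, (z, w) ∈ t → u ≤ ∑ k, ψ k (z k) + ∑ a, w a * lam a := by
  obtain ⟨f, u, h1, h2⟩ := geometric_hahn_banach_open hs ho ht hst
  obtain ⟨ψ, lam, hf⟩ := exists_eq_sum_of_pi_prod f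
  exact ⟨ψ, lam, u, fun z w h => hf z w ▸ h1 _ h, fun z w h => hf z w ▸ h2 _ h⟩

/-- A weak* continuous approximation of an operator `R : Z* → G`, subject to finitely many norm
constraints. -/
theorem exists_approx_of_finite (c : Module.Basis ι ℝ G) (R : StrongDual ℝ Z →L[ℝ] G)
    (Q : ConvexCone ℝ Z) (hQ0 : (0 : Z) ∈ Q)
    (hR : ∀ i, ∀ χ : StrongDual ℝ Z, (∀ q ∈ Q, 0 ≤ χ q) → 0 ≤ c.coord i (R χ))
    {κ : Type*} [Fintype κ] (φ : κ → StrongDual ℝ Z)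
    {K : Type*} [Fintype K] (ξ : K → StrongDual ℝ G) (hξ : ∀ k, ‖ξ k‖ ≤ 1)
    {r ε : ℝ} (hr : ‖R‖ < r) (hε : 0 < ε) :
    ∃ g : ι → Z, (∀ i, g i ∈ Q) ∧ (∀ k, ‖evalSum c g (ξ k)‖ < r) ∧
      ∀ j i, |φ j (g i) - c.coord i (R (φ j))| < ε := by
  classical
  have hr0 : 0 < r := (norm_nonneg R).trans_lt hr
  -- `D g` collects all quantities that the conclusion constrains, so the claim is that the image of
  -- the cone `Q^ι` under `D` meets a product of two open balls.
  obtain ⟨D, hD⟩ : ∃ D : (ι → Z) →ₗ[ℝ] (K → Z) × (κ × ι → ℝ),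
      ∀ g, D g = (fun k => ∑ i, ξ k (c i) • g i, fun a => φ a.1 (g a.2)) :=
    ⟨{  toFun := fun g => (fun k => ∑ i, ξ k (c i) • g i, fun a => φ a.1 (g a.2))
        map_add' := fun g h => by
          ext <;> simp [Finset.sum_add_distrib]
        map_smul' := fun t g => by
          ext
          · simp only [Pi.smul_apply, Finset.smul_sum, smul_smul, mul_comm, RingHom.id_apply,
              Prod.smul_mk]
          · simp }, fun _ => rfl⟩
  have hcone : Convex ℝ {g : ι → Z | ∀ i, g i ∈ Q} := fun g hg h hh a b ha hb hab i =>
    Q.convex (hg i) (hh i) ha hb hab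
  generalize hτ : (fun a : κ × ι => c.coord a.2 (R (φ a.1))) = τ
  by_contra hcon
  have hdisj : Disjoint (Metric.ball (0 : K → Z) r ×ˢ Metric.ball τ ε)
      (D '' {g : ι → Z | ∀ i, g i ∈ Q}) := by
    rw [Set.disjoint_left]
    rintro _ ⟨h1, h2⟩ ⟨g, hg, rfl⟩
    rw [hD] at h1 h2
    refine hcon ⟨g, hg, fun k => ?_, fun j i => ?_⟩
    · rw [mem_ball_zero_iff, pi_norm_lt_iff hr0] at h1
      simpa using h1 k
    · rw [mem_ball_iff_norm, pi_norm_lt_iff hε, ← hτ] at h2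
      exact h2 (j, i)
  obtain ⟨ψ, lam, u, hfO, hfD⟩ := exists_separating_pi_prod
    ((convex_ball (0 : K → Z) r).prod (convex_ball τ ε)) (Metric.isOpen_ball.prod Metric.isOpen_ball)
    (hcone.linear_image D) hdisj
  -- The separating functional pulled back along `D`, written by its components on `Z^ι`.
  obtain ⟨χ, hχd⟩ : ∃ χ : ι → StrongDual ℝ Z,
      ∀ i, χ i = ∑ k, ξ k (c i) • ψ k + ∑ j, lam (j, i) • φ j := ⟨_, fun _ => rfl⟩
  have hfg : ∀ g : ι → Z, (∀ i, g i ∈ Q) → u ≤ ∑ i, χ i (g i) := by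
    intro g hg
    refine (hfD _ _ ⟨g, hg, hD g⟩).trans_eq ?_
    simp only [map_sum, map_smul, smul_eq_mul, hχd, _root_.add_apply,
      _root_.sum_apply, _root_.smul_apply, Finset.sum_add_distrib,
      Fintype.sum_prod_type_right]
    congr 1
    · rw [Finset.sum_comm]
    · simp only [mul_comm]
  have hu0 : u ≤ 0 := by
    simpa using hfg 0 fun i => hQ0
  have hχ : ∀ i, ∀ q ∈ Q, 0 ≤ χ i q := by
    intro i q hq
    by_contra hneg
    rw [not_le] at hneg
    have hmem : ∀ t : ℝ, 0 < t → u ≤ t * χ i q := by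
      intro t ht
      have := hfg (Pi.single i (t • q)) fun j => ?_
      · rw [Finset.sum_eq_single i (fun j _ hj => by simp [hj]) (by simp)] at this
        simpa using this
      · by_cases hj : j = i
        · subst hj
          simpa using Q.smul_mem ht hq
        · simpa [hj] using hQ0
    -- A functional bounded below on a cone is nonnegative there: for this `t` the bound would read
    -- `u ≤ u - 1`.
    have h1 := hmem ((u - 1) / χ i q) (div_pos_of_neg_of_neg (by linarith) hneg)
    rw [div_mul_cancel₀ _ hneg.ne] at h1
    linarith
  have hnn : 0 ≤ ∑ i, c.coord i (R (χ i)) := Finset.sum_nonneg fun i _ => hR i _ (hχ i)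
  have hsum : ∑ i, c.coord i (R (χ i)) = ∑ k, ξ k (R (ψ k)) + ∑ a, τ a * lam a := by
    simp only [hχd, ← hτ, map_add, map_sum, map_smul, smul_eq_mul, Finset.sum_add_distrib,
      Fintype.sum_prod_type_right]
    congr 1
    · rw [Finset.sum_comm]
      exact Finset.sum_congr rfl fun k _ => (dual_eq_sum_coord c _ _).symm
    · simp only [mul_comm]
  -- The contradiction: at `(v, τ)` the functional is below `u ≤ 0`, yet it is at least `∑ ξ k (R (ψ
  -- k)) + ∑ τ a * lam a`, which is the nonnegative sum of the coordinates of `R (χ i)`.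
  choose v hv hψv using fun k => exists_norm_lt_le_apply (ψ := ψ k) (norm_nonneg R) hr
  have hlt := hfO v τ ⟨by
    rw [mem_ball_zero_iff, pi_norm_lt_iff hr0]; exact hv, Metric.mem_ball_self hε⟩
  have hle : ∑ k, ξ k (R (ψ k)) ≤ ∑ k, ψ k (v k) := by
    refine Finset.sum_le_sum fun k _ => (le_abs_self _).trans (le_trans ?_ (hψv k))
    refine ((ξ k).le_opNorm _).trans ?_
    calc ‖ξ k‖ * ‖R (ψ k)‖ ≤ 1 * (‖R‖ * ‖ψ k‖) :=
          mul_le_mul (hξ k) (R.le_opNorm _) (norm_nonneg _) zero_le_one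
      _ = _ := one_mul _
  linarith

/-- **Local reflexivity relative to a cone**: an operator `R : Z* → G` into a finite dimensional
space is approximated on a finite set by weak* continuous operators with coordinates in the cone
`Q ⊆ Z`, with almost the same norm, provided that the coordinates of `R` are in the bipolar of
`Q`. -/
theorem exists_localReflexivity (c : Module.Basis ι ℝ G) (R : StrongDual ℝ Z →L[ℝ] G)
    (Q : ConvexCone ℝ Z) (hQ0 : (0 : Z) ∈ Q)
    (hR : ∀ i, ∀ χ : StrongDual ℝ Z, (∀ q ∈ Q, 0 ≤ χ q) → 0 ≤ c.coord i (R χ))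
    {κ : Type*} [Fintype κ] (φ : κ → StrongDual ℝ Z) {δ ε : ℝ} (hδ : 0 < δ) (hε : 0 < ε) :
    ∃ g : ι → Z, (∀ i, g i ∈ Q) ∧ ‖evalSum c g‖ ≤ ‖R‖ + δ ∧
      ∀ j i, |φ j (g i) - c.coord i (R (φ j))| < ε := by
  -- Mesh of a finite net of the unit ball of `G*`: a bound `‖R‖ + δ / 2` on the net becomes `(‖R‖ +
  -- δ / 2) / (1 - η) ≤ ‖R‖ + δ` on the ball.
  obtain ⟨η, hη0, hη1, hη⟩ : ∃ η : ℝ, 0 < η ∧ η < 1 ∧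
      ‖R‖ + δ / 2 ≤ (1 - η) * (‖R‖ + δ) := by
    have hp : 0 < ‖R‖ + δ := by positivity
    refine ⟨δ / 2 / (‖R‖ + δ), by positivity, ?_, ?_⟩
    · rw [div_lt_one hp]
      linarith [norm_nonneg R]
    · rw [sub_mul, div_mul_cancel₀ _ hp.ne']
      linarith
  have : FiniteDimensional ℝ (StrongDual ℝ G) :=
    inferInstanceAs (FiniteDimensional ℝ (G →L[ℝ] ℝ))
  have : ProperSpace (StrongDual ℝ G) := FiniteDimensional.proper ℝ _
  obtain ⟨t, hts, htf, hcov⟩ := IsCompact.finite_cover_balls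
    (isCompact_closedBall (0 : StrongDual ℝ G) 1) hη0
  have := htf.fintype
  obtain ⟨g, hgQ, hgn, hg⟩ := exists_approx_of_finite c R Q hQ0 hR φ (K := t) (fun k => k.1)
    (fun k => mem_closedBall_zero_iff.1 (hts k.2)) (r := ‖R‖ + δ / 2) (by linarith) hε
  refine ⟨g, hgQ, ?_, hg⟩
  have hbound : ‖evalSum c g‖ ≤ ‖R‖ + δ / 2 + η * ‖evalSum c g‖ := by
    refine ContinuousLinearMap.opNorm_le_of_unit_norm (by positivity) fun ξ hξ => ?_
    obtain ⟨k, hk, hξk⟩ := Set.mem_iUnion₂.1 (hcov (mem_closedBall_zero_iff.2 hξ.le))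
    have h1 : evalSum c g ξ = evalSum c g k + evalSum c g (ξ - k) := by
      rw [← map_add, add_sub_cancel]
    rw [h1]
    refine (norm_add_le _ _).trans (add_le_add (hgn ⟨k, hk⟩).le ?_)
    refine ((evalSum c g).le_opNorm _).trans ?_
    rw [mul_comm]
    gcongr
    exact (mem_ball_iff_norm.1 hξk).le
  nlinarith

end LocalReflexivity

/-! ### Partitions of an element of a lattice ordered group -/

section LatticeGroup

variable {α : Type*} [Lattice α] [AddCommGroup α] [IsOrderedAddMonoid α]

theorem inf_add_le_inf_add_inf {a b c : α} (ha : 0 ≤ a) (hb : 0 ≤ b) (hc : 0 ≤ c) :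
    a ⊓ (b + c) ≤ a ⊓ b + a ⊓ c := by
  rw [inf_add, add_inf, add_inf]
  refine le_inf (le_inf ?_ ?_) (le_inf ?_ ?_)
  · exact inf_le_left.trans (le_add_of_nonneg_left ha)
  · exact inf_le_left.trans (le_add_of_nonneg_right hc)
  · exact inf_le_left.trans (le_add_of_nonneg_left hb)
  · exact inf_le_right

theorem inf_sum_le_sum_inf {ι : Type*} (s : Finset ι) {a : α} {b : ι → α} (ha : 0 ≤ a)
    (hb : ∀ i, 0 ≤ b i) : a ⊓ ∑ i ∈ s, b i ≤ ∑ i ∈ s, a ⊓ b i := by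
  classical
  induction s using Finset.induction_on with
  | empty => simp
  | insert i s hi ih =>
    rw [Finset.sum_insert hi, Finset.sum_insert hi]
    exact (inf_add_le_inf_add_inf ha (hb i) (Finset.sum_nonneg fun i _ => hb i)).trans
      (add_le_add le_rfl ih)

theorem inf_le_inf_zero_of_le {a b c : α} (h : a ⊓ c ≤ 0) (hb : b ≤ a) : b ⊓ c ≤ 0 :=
  (inf_le_inf_right c hb).trans h

theorem posPart_inf_neg_posPart_le (x : α) : x⁺ ⊓ (-x)⁺ ≤ 0 := by
  rw [posPart_neg, posPart_inf_negPart_eq_zero]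

/-- If `∑ aⱼ = a` then `∑ x⁺ ⊓ aⱼ ≤ (x + a)⁺`. -/
theorem sum_posPart_inf_le {ι : Type*} (s : Finset ι) {a x : α} {b : ι → α} (hb : ∀ i, 0 ≤ b i)
    (hs : ∑ i ∈ s, b i = a) : ∑ i ∈ s, x⁺ ⊓ b i ≤ (x + a)⁺ := by
  set z := ∑ i ∈ s, x⁺ ⊓ b i with hz
  have hz0 : 0 ≤ z := Finset.sum_nonneg fun i _ => le_inf (posPart_nonneg x) (hb i)
  have hza : z ≤ a := hs ▸ Finset.sum_le_sum fun i _ => inf_le_right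
  -- Each summand of `z` lies below `x⁺`, so `z` is disjoint from `x⁻`. Hence `x⁻` can be dropped
  -- from the bound `z ≤ (x + a)⁺ + x⁻`.
  have hzx : z ⊓ x⁻ ≤ 0 := by
    rw [inf_comm]
    refine (inf_sum_le_sum_inf s (negPart_nonneg x)
      fun i => le_inf (posPart_nonneg x) (hb i)).trans (Finset.sum_nonpos fun i _ => ?_)
    rw [inf_comm, ← posPart_neg]
    exact inf_le_inf_zero_of_le (posPart_inf_neg_posPart_le x) inf_le_left
  have h1 : z ≤ (x + a)⁺ + x⁻ := by
    refine hza.trans ?_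
    calc a = (x + a) + (x⁻ - x⁺) := by
          rw [← neg_sub x⁺, posPart_sub_negPart]; abel
      _ ≤ (x + a)⁺ + x⁻ := add_le_add (le_posPart _) (sub_le_self _ (posPart_nonneg x))
  calc z = z ⊓ ((x + a)⁺ + x⁻) := (inf_eq_left.2 h1).symm
    _ ≤ z ⊓ (x + a)⁺ + z ⊓ x⁻ :=
      inf_add_le_inf_add_inf hz0 (posPart_nonneg _) (negPart_nonneg _)
    _ ≤ (x + a)⁺ + 0 := add_le_add inf_le_right hzx
    _ = _ := add_zero _

theorem posPart_eq_inf_add {x a : α} (ha : 0 ≤ a) : x⁺ = x⁺ ⊓ a + (x - a)⁺ := by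
  have h : (x - a)⁺ = x⁺ ⊔ a - a := by
    rw [posPart_def, posPart_def, sup_assoc, sup_eq_right.2 ha, sup_sub, sub_self]
  rw [h, add_sub_assoc', inf_add_sup, add_sub_cancel_right]

/-- A layer of the slicing of `b` along `w` at the levels `k • a`. -/
def slice (w a b : α) (k : ℕ) : α := (w - k • a)⁺ ⊓ b - (w - (k + 1) • a)⁺ ⊓ b

variable {w a b : α}

theorem slice_nonneg (ha : 0 ≤ a) (k : ℕ) : 0 ≤ slice w a b k := by
  refine sub_nonneg.2 (inf_le_inf_right b (posPart_mono (sub_le_sub_left ?_ w)))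
  rw [succ_nsmul]
  exact le_add_of_nonneg_right ha

theorem posPart_sub_nsmul_eq_zero {N : ℕ} (hw : w ≤ N • a) : (w - N • a)⁺ = 0 :=
  posPart_eq_zero.2 (sub_nonpos.2 hw)

theorem sum_slice {N : ℕ} (ha : 0 ≤ a) (hb : 0 ≤ b) (hba : b ≤ a) (haw : a ≤ w)
    (hw : w ≤ N • a) : ∑ k ∈ Finset.range N, slice w a b k = b := by
  unfold slice
  rw [Finset.sum_range_sub' fun k => (w - k • a)⁺ ⊓ b, posPart_sub_nsmul_eq_zero hw,
    inf_eq_left.2 hb, zero_nsmul, sub_zero, sub_zero, posPart_of_nonneg (ha.trans haw),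
    inf_eq_right.2 (hba.trans haw)]

theorem slice_inf_lower (hb : 0 ≤ b) (k : ℕ) : slice w a b k ⊓ (k • a - w)⁺ ≤ 0 := by
  have h := posPart_inf_neg_posPart_le (w - k • a)
  rw [neg_sub] at h
  refine inf_le_inf_zero_of_le h ((sub_le_self _ ?_).trans inf_le_left)
  exact le_inf (posPart_nonneg _) hb

/-- Slices replace band projections, which need not exist. Their edges are not sharp: the layer of
level `k` may reach up to level `k + 2`, whence the width 2 instead of 1. -/
theorem slice_inf_upper (hba : b ≤ a) (k : ℕ) :
    slice w a b k ⊓ (w - (k + 2) • a)⁺ ≤ 0 := by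
  have h := posPart_inf_neg_posPart_le ((k + 2) • a - w)
  rw [neg_sub] at h
  refine inf_le_inf_zero_of_le h ?_
  calc slice w a b k ≤ b - (w - (k + 1) • a)⁺ ⊓ b := sub_le_sub_right inf_le_right _
    _ = (b - (w - (k + 1) • a)⁺)⁺ := by
        rw [sub_inf, sub_self, posPart_def (b - _)]
    _ ≤ ((k + 2) • a - w)⁺ := by
        refine posPart_mono ((sub_le_sub hba (le_posPart _)).trans_eq ?_)
        rw [show k + 2 = (k + 1) + 1 from rfl, succ_nsmul _ (k + 1)]
        abel

/-- Summation by parts; the boundary term vanishes because `w ≤ N • a`. -/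
theorem sum_nsmul_slice {N : ℕ} (hb : 0 ≤ b) (hw : w ≤ N • a) :
    ∑ k ∈ Finset.range N, k • slice w a b k =
      ∑ k ∈ Finset.range N, (w - (k + 1) • a)⁺ ⊓ b := by
  have key : ∀ n : ℕ, ∑ k ∈ Finset.range n, k • slice w a b k =
      ∑ k ∈ Finset.range n, (w - (k + 1) • a)⁺ ⊓ b - n • ((w - n • a)⁺ ⊓ b) := by
    intro n
    induction n with
    | zero => simp
    | succ n ih =>
      rw [Finset.sum_range_succ, ih, Finset.sum_range_succ, slice]
      generalize (w - (n + 1) • a)⁺ ⊓ b = q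
      generalize (w - n • a)⁺ ⊓ b = r
      rw [nsmul_sub, succ_nsmul]
      abel
  rw [key, posPart_sub_nsmul_eq_zero hw, inf_eq_left.2 hb, nsmul_zero, sub_zero]

/-- The layer cake decomposition of `w`: each layer is a difference of consecutive truncations, and
the sum telescopes. -/
theorem eq_sum_posPart_inf {N : ℕ} (ha : 0 ≤ a) (hw0 : 0 ≤ w) (hw : w ≤ N • a) :
    w = ∑ k ∈ Finset.range N, (w - k • a)⁺ ⊓ a := by
  have h : ∀ k : ℕ, (w - k • a)⁺ ⊓ a = (w - k • a)⁺ - (w - (k + 1) • a)⁺ := by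
    intro k
    have := posPart_eq_inf_add (x := w - k • a) ha
    rw [eq_sub_iff_add_eq]
    conv_rhs => rw [this]
    rw [succ_nsmul, sub_add_eq_sub_sub]
  simp only [h]
  rw [Finset.sum_range_sub' fun k => (w - k • a)⁺, posPart_sub_nsmul_eq_zero hw, zero_nsmul,
    sub_zero, sub_zero, posPart_of_nonneg hw0]

/-- After summation by parts, the terms of level `k` add up over `j` to something between the layers
`k + 1` and `k` of `w`. Summing the layers gives `w`, and dropping layer `0` loses at most `a`. -/
theorem sum_sum_nsmul_slice_mem {ι : Type*} [Fintype ι] {N : ℕ} {b : ι → α} (hb : ∀ j, 0 ≤ b j)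
    (hs : ∑ j, b j = a) (haw : a ≤ w) (hw : w ≤ N • a) :
    w - a ≤ ∑ j, ∑ k ∈ Finset.range N, k • slice w a (b j) k ∧
      ∑ j, ∑ k ∈ Finset.range N, k • slice w a (b j) k ≤ w := by
  have ha : 0 ≤ a := hs ▸ Finset.sum_nonneg fun j _ => hb j
  have hw0 := ha.trans haw
  simp only [sum_nsmul_slice (hb _) hw]
  rw [Finset.sum_comm]
  have hW := eq_sum_posPart_inf ha hw0 hw
  constructor
  · have h1 : ∑ k ∈ Finset.range N, (w - (k + 1) • a)⁺ ⊓ a =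
        ∑ k ∈ Finset.range N, (w - k • a)⁺ ⊓ a + (w - N • a)⁺ ⊓ a - (w - 0 • a)⁺ ⊓ a := by
      rw [← Finset.sum_range_succ (fun k => (w - k • a)⁺ ⊓ a), Finset.sum_range_succ',
        add_sub_cancel_right]
    rw [posPart_sub_nsmul_eq_zero hw, inf_eq_left.2 ha, add_zero, ← hW] at h1
    calc w - a ≤ w - (w - 0 • a)⁺ ⊓ a := sub_le_sub_left inf_le_right _
      _ = _ := h1.symm
      _ ≤ _ := Finset.sum_le_sum fun k _ => by
        have := inf_sum_le_sum_inf Finset.univ (posPart_nonneg (w - (k + 1) • a)) hb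
        rwa [hs] at this
  · conv_rhs => rw [hW]
    refine Finset.sum_le_sum fun k _ => le_inf ?_ ?_
    · refine (sum_posPart_inf_le _ hb hs).trans_eq ?_
      rw [succ_nsmul]
      congr 1
      abel
    · exact (Finset.sum_le_sum fun j _ => inf_le_right).trans_eq hs

/-- A simultaneous partition of `a` adapted to finitely many elements `wᵢ`: on the part `bⱼ`
the element `wᵢ` is between `kᵢⱼ • a` and `(kᵢⱼ + 2) • a`. -/
theorem exists_partition {κ : Type*} (w : κ → α) {N : ℕ} (ha : 0 ≤ a) (haw : ∀ i, a ≤ w i)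
    (hw : ∀ i, w i ≤ N • a) (s : Finset κ) :
    ∃ (ι : Type) (_ : Fintype ι) (b : ι → α) (k : κ → ι → ℕ), (∀ j, 0 ≤ b j) ∧ ∑ j, b j = a ∧
      ∀ i ∈ s, (∀ j, b j ⊓ (k i j • a - w i)⁺ ≤ 0) ∧
        (∀ j, b j ⊓ (w i - (k i j + 2) • a)⁺ ≤ 0) ∧
        w i - a ≤ ∑ j, k i j • b j ∧ ∑ j, k i j • b j ≤ w i := by
  classical
  induction s using Finset.induction_on with
  | empty => exact ⟨Unit, inferInstance, fun _ => a, fun _ _ => 0, fun _ => ha, by simp, by simp⟩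
  | insert i s hi ih =>
    obtain ⟨ι, _, b, k, hb, hs, h⟩ := ih
    have hba : ∀ j, b j ≤ a := fun j =>
      hs ▸ Finset.single_le_sum (fun j _ => hb j) (Finset.mem_univ j)
    have hsum : ∀ j, ∑ l : Fin N, slice (w i) a (b j) l = b j := fun j => by
      rw [Fin.sum_univ_eq_sum_range (fun l => slice (w i) a (b j) l),
        sum_slice ha (hb j) (hba j) (haw i) (hw i)]
    have hle : ∀ j (l : Fin N), slice (w i) a (b j) l ≤ b j := fun j l => by
      conv_rhs => rw [← hsum j]
      exact Finset.single_le_sum (f := fun l : Fin N => slice (w i) a (b j) l)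
        (fun l _ => slice_nonneg ha _) (Finset.mem_univ l)
    -- Every part is sliced along the new element. Estimates for earlier elements persist, since the
    -- pieces lie below the old parts and add up to them.
    refine ⟨ι × Fin N, inferInstance, fun q => slice (w i) a (b q.1) q.2,
      fun i' q => if i' = i then q.2 else k i' q.1, fun q => slice_nonneg ha _, ?_, ?_⟩
    · rw [Fintype.sum_prod_type]
      simp only [hsum, hs]
    · intro i' hi'
      by_cases hii : i' = i
      · subst hii
        simp only [if_true]
        refine ⟨fun q => slice_inf_lower (hb _) _, fun q => slice_inf_upper (hba _) _, ?_⟩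
        rw [Fintype.sum_prod_type]
        have := sum_sum_nsmul_slice_mem hb hs (haw i') (hw i')
        have e : ∀ j, ∑ l : Fin N, (l : ℕ) • slice (w i') a (b j) l =
            ∑ l ∈ Finset.range N, l • slice (w i') a (b j) l := fun j =>
          Fin.sum_univ_eq_sum_range (fun l => l • slice (w i') a (b j) l) N
        simpa only [e] using this
      · obtain ⟨h1, h2, h3⟩ := h i' (Finset.mem_of_mem_insert_of_ne hi' hii)
        simp only [if_neg hii]
        refine ⟨fun q => inf_le_inf_zero_of_le (h1 q.1) (hle _ _),
          fun q => inf_le_inf_zero_of_le (h2 q.1) (hle _ _), ?_⟩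
        rw [Fintype.sum_prod_type]
        simpa only [← Finset.smul_sum, hsum] using h3

end LatticeGroup

/-! ### Positive finite rank operators are limits of sums of positive rank one operators -/

section Functional

variable {Y : Type*} [NormedAddCommGroup Y] [NormedSpace ℝ Y] [Lattice Y] [IsBanachLattice Y]

/-- Disjointness from `b` passes to integer multiples by `inf_sum_le_sum_inf`, hence to anything
below one. -/
theorem smul_inf_nonpos {y b : Y} (hy : 0 ≤ y) (hb : 0 ≤ b) (c : ℝ)
    (h : y ⊓ b ≤ 0) : (c • y) ⊓ b ≤ 0 := by
  obtain ⟨n, hn⟩ := exists_nat_ge c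
  have h1 : c • y ≤ n • y := by
    rw [← Nat.cast_smul_eq_nsmul ℝ]
    exact smul_le_smul_of_nonneg_right hn hy
  refine (inf_le_inf_right b h1).trans ?_
  rw [inf_comm]
  have := inf_sum_le_sum_inf (Finset.range n) hb (b := fun _ => y) fun _ => hy
  simp only [Finset.sum_const, Finset.card_range] at this
  refine this.trans (nsmul_nonpos ?_ n)
  rwa [inf_comm]

theorem posPart_smul_of_nonneg {c : ℝ} (hc : 0 ≤ c) (y : Y) : (c • y)⁺ ≤ c • y⁺ := by
  rw [posPart_def]
  exact sup_le (smul_le_smul_of_nonneg_left (le_posPart y) hc)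
    (smul_nonneg hc (posPart_nonneg y))

/-- For `0 ≠ b ∈ [0, a]`, there is a linear functional bounded by the essential supremum of
`L x / a` on the support of `b`. -/
theorem exists_functional_le {E : Type*} [AddCommGroup E] [Module ℝ E] (L : E →ₗ[ℝ] Y) {a b : Y}
    (hL : ∀ x, ∃ t : ℝ, L x ≤ t • a) (hb : 0 ≤ b) (hba : b ≤ a) (hb0 : b ≠ 0) :
    ∃ φ : E →ₗ[ℝ] ℝ, ∀ x t, (L x - t • a)⁺ ⊓ b ≤ 0 → φ x ≤ t := by
  set T : E → Set ℝ := fun x => {t | (L x - t • a)⁺ ⊓ b ≤ 0} with hT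
  have ha : 0 ≤ a := hb.trans hba
  have hne : ∀ x, (T x).Nonempty := fun x => by
    obtain ⟨t, ht⟩ := hL x
    refine ⟨t, ?_⟩
    change _ ⊓ _ ≤ _
    rw [posPart_eq_zero.2 (sub_nonpos.2 ht)]
    exact inf_le_left
  have hadd : ∀ x y s t, s ∈ T x → t ∈ T y → s + t ∈ T (x + y) := by
    intro x y s t hs ht
    have h1 : (L (x + y) - (s + t) • a)⁺ ≤ (L x - s • a)⁺ + (L y - t • a)⁺ := by
      rw [posPart_def]
      refine sup_le ?_ (add_nonneg (posPart_nonneg _) (posPart_nonneg _))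
      refine le_trans (le_of_eq ?_) (add_le_add (le_posPart _) (le_posPart _))
      rw [map_add, add_smul]
      abel
    change _ ⊓ _ ≤ _
    refine (inf_le_inf_right b h1).trans ?_
    rw [inf_comm]
    refine (inf_add_le_inf_add_inf hb (posPart_nonneg _) (posPart_nonneg _)).trans ?_
    rw [inf_comm b, inf_comm b]
    exact add_nonpos hs ht
  -- This is where `b ≠ 0` enters: a negative `t` would make a positive multiple of `b` disjoint
  -- from `b`.
  have hzero : ∀ t ∈ T 0, 0 ≤ t := by
    intro t ht
    by_contra hneg
    rw [not_le] at hneg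
    have ht' : (L 0 - t • a)⁺ ⊓ b ≤ 0 := ht
    have hx : (0 : ℝ) < -t := by linarith
    rw [map_zero, zero_sub, ← neg_smul] at ht'
    have h1 : ((-t) • b) ⊓ b ≤ 0 := by
      refine (inf_le_inf_right b ?_).trans ht'
      exact (smul_le_smul_of_nonneg_left hba hx.le).trans (le_posPart _)
    have h2 := smul_inf_nonpos (smul_nonneg hx.le hb) hb (-t)⁻¹ h1
    rw [smul_smul, inv_mul_cancel₀ hx.ne', one_smul, inf_idem] at h2
    exact hb0 (le_antisymm h2 hb)
  have hbdd : ∀ x, BddBelow (T x) := fun x => by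
    obtain ⟨s, hs⟩ := hne (-x)
    refine ⟨-s, fun t ht => ?_⟩
    have := hzero _ (by simpa using hadd x (-x) t s ht hs)
    linarith
  have hsmul : ∀ c : ℝ, 0 < c → ∀ x t, t ∈ T x → c * t ∈ T (c • x) := by
    intro c hc x t ht
    change _ ⊓ _ ≤ _
    rw [map_smul, mul_smul, ← smul_sub]
    exact (inf_le_inf_right b (posPart_smul_of_nonneg hc.le _)).trans
      (smul_inf_nonpos (posPart_nonneg _) hb c ht)
  have hhom : ∀ c : ℝ, 0 < c → ∀ x, sInf (T (c • x)) ≤ c * sInf (T x) := by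
    intro c hc x
    rw [← div_le_iff₀' hc]
    refine le_csInf (hne x) fun t ht => ?_
    rw [div_le_iff₀' hc]
    exact csInf_le (hbdd _) (hsmul c hc x t ht)
  -- `sInf (T x)`, the essential supremum of `L x / a` on the support of `b`, is sublinear;
  -- Hahn–Banach extends the zero functional on the zero subspace under it.
  obtain ⟨φ, -, hφ⟩ := exists_extension_of_le_sublinear (⊥ : E →ₗ.[ℝ] ℝ) (fun x => sInf (T x))
    (fun c hc x => le_antisymm (hhom c hc x) (by
      have := hhom c⁻¹ (inv_pos.2 hc) (c • x)
      rw [smul_smul, inv_mul_cancel₀ hc.ne', one_smul] at this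
      calc c * sInf (T x) ≤ c * (c⁻¹ * sInf (T (c • x))) := mul_le_mul_of_nonneg_left this hc.le
        _ = sInf (T (c • x)) := mul_inv_cancel_left₀ hc.ne' _))
    (fun x y => by
      rw [← sub_le_iff_le_add]
      refine le_csInf (hne x) fun s hs => ?_
      rw [sub_le_comm]
      refine le_csInf (hne y) fun t ht => ?_
      rw [sub_le_iff_le_add']
      exact csInf_le (hbdd _) (hadd x y s t hs ht))
    (fun x => by
      have hx : (x : E) = 0 := (Submodule.mem_bot ℝ).1 x.2
      have h0 : (⊥ : E →ₗ.[ℝ] ℝ) x = 0 := by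
        have : x = 0 := Subtype.ext hx
        rw [this, LinearPMap.map_zero]
      rw [h0, hx]
      exact le_csInf (hne 0) hzero)
  exact ⟨φ, fun x t ht => (hφ x).trans (csInf_le (hbdd x) ht)⟩

end Functional

section PositiveApprox

variable {X : Type*} [NormedAddCommGroup X] [NormedSpace ℝ X] [Lattice X] [IsBanachLattice X]
  {Y : Type*} [NormedAddCommGroup Y] [NormedSpace ℝ Y] [Lattice Y] [IsBanachLattice Y]

/-- Writing the vectors as values of `T` shows that a functional vanishing on the kernel of `T` is
determined by its values at the `x k`. -/
theorem ContinuousLinearMap.IsFiniteRank.exists_eq_sum_apply {E F : Type*} [NormedAddCommGroup E]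
    [NormedSpace ℝ E] [NormedAddCommGroup F] [NormedSpace ℝ F] {T : E →L[ℝ] F}
    (hT : T.IsFiniteRank) :
    ∃ (n : ℕ) (β : Fin n → StrongDual ℝ E) (x : Fin n → E), ∀ y, T y = ∑ k, β k y • T (x k) := by
  have : FiniteDimensional ℝ (LinearMap.range (T : E →ₗ[ℝ] F)) := hT
  let b := Module.finBasis ℝ (LinearMap.range (T : E →ₗ[ℝ] F))
  let T₁ : E →L[ℝ] LinearMap.range (T : E →ₗ[ℝ] F) :=
    T.codRestrict _ fun x => LinearMap.mem_range_self (T : E →ₗ[ℝ] F) x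
  choose x hx using fun k => (b k).2
  refine ⟨_, fun k => (b.coord k).toContinuousLinearMap.comp T₁, x, fun y => ?_⟩
  have h := congrArg (Subtype.val) (b.sum_repr (T₁ y))
  simp only [Submodule.coe_sum, Submodule.coe_smul] at h
  refine h.symm.trans (Finset.sum_congr rfl fun k _ => ?_)
  rw [← hx k]
  rfl

theorem abs_smul_le (c : ℝ) {v e : Y} (h1 : v ≤ e) (h2 : -e ≤ v) : c • v ≤ |c| • e := by
  rcases le_total 0 c with hc | hc
  · rw [abs_of_nonneg hc]
    exact smul_le_smul_of_nonneg_left h1 hc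
  · rw [abs_of_nonpos hc, ← neg_smul_neg c]
    exact smul_le_smul_of_nonneg_left (neg_le.1 h2) (neg_nonneg.2 hc)

/-- The functional of `exists_functional_le` for a positive operator of finite rank is a continuous
positive functional. -/
theorem exists_positive_functional {B : X →L[ℝ] Y} (hB : B.IsPositiveOp) {n : ℕ}
    {β : Fin n → StrongDual ℝ X} {x : Fin n → X} (hβ : ∀ y, B y = ∑ k, β k y • B (x k))
    {a b : Y} {M : ℝ} (h1 : ∀ k, B (x k) ≤ M • a) (h2 : ∀ k, -(M • a) ≤ B (x k))
    (hb : 0 ≤ b) (hba : b ≤ a) :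
    ∃ f : StrongDual ℝ X, 0 ≤ f ∧ (∀ y, f y = ∑ k, β k y * f (x k)) ∧
      (b ≠ 0 → ∀ y t, (B y - t • a)⁺ ⊓ b ≤ 0 → f y ≤ t) := by
  by_cases hb0 : b = 0
  · exact ⟨0, le_rfl, by simp, fun h => absurd hb0 h⟩
  have hdom : ∀ y, B y ≤ ((∑ k, |β k y|) * M) • a := by
    intro y
    rw [hβ y, mul_smul, Finset.sum_smul]
    exact Finset.sum_le_sum fun k _ => abs_smul_le _ (h1 k) (h2 k)
  obtain ⟨φ, hφ⟩ := exists_functional_le (B : X →ₗ[ℝ] Y) (fun y => ⟨_, hdom y⟩) hb hba hb0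
  have hφ' : ∀ y t, B y ≤ t • a → φ y ≤ t := by
    intro y t h
    refine hφ y t ?_
    change (B y - t • a)⁺ ⊓ b ≤ 0
    rw [posPart_eq_zero.2 (sub_nonpos.2 h)]
    exact inf_le_left
  have hM : ∀ y, (∑ k, |β k y|) * M ≤ ((∑ k, ‖β k‖) * |M|) * ‖y‖ := by
    intro y
    calc (∑ k, |β k y|) * M ≤ (∑ k, |β k y|) * |M| :=
          mul_le_mul_of_nonneg_left (le_abs_self M) (Finset.sum_nonneg fun k _ => abs_nonneg _)
      _ ≤ (∑ k, ‖β k‖ * ‖y‖) * |M| := by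
          gcongr with k
          exact (β k).le_opNorm y
      _ = _ := by rw [← Finset.sum_mul]; ring
  let f : StrongDual ℝ X := φ.mkContinuous ((∑ k, ‖β k‖) * |M|) fun y => by
    rw [Real.norm_eq_abs, abs_le]
    constructor
    · have := (hφ' (-y) _ (hdom (-y))).trans (hM (-y))
      rw [map_neg, norm_neg] at this
      linarith
    · exact (hφ' y _ (hdom y)).trans (hM y)
  have hker : ∀ y, B y = 0 → φ y = 0 := by
    intro y hy
    have e1 := hφ' y 0 (by simp [hy])
    have e2 := hφ' (-y) 0 (by simp [hy])
    rw [map_neg] at e2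
    linarith
  refine ⟨f, fun y hy => ?_, fun y => ?_, fun _ => hφ⟩
  · have := hφ' (-y) 0 (by
      rw [map_neg, zero_smul]
      exact neg_nonpos.2 (hB y hy))
    rw [map_neg] at this
    change 0 ≤ φ y
    linarith
  · have := hker (y - ∑ k, β k y • x k) (by
      rw [map_sub, map_sum]
      simp only [map_smul]
      rw [← hβ, sub_self])
    rw [map_sub, map_sum] at this
    simp only [map_smul, smul_eq_mul] at this
    exact sub_eq_zero.1 this

theorem norm_le_two_mul_of_mem {a d : Y} (h1 : -((2 : ℕ) • a) ≤ d) (h2 : d ≤ a) (ha : 0 ≤ a) :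
    ‖d‖ ≤ 2 * ‖a‖ := by
  have : ‖d‖ ≤ ‖(2 : ℕ) • a‖ := by
    refine norm_le_norm_of_abs_le_abs ?_
    rw [abs_of_nonneg (nsmul_nonneg ha 2), abs_le']
    refine ⟨h2.trans ?_, neg_le.1 h1⟩
    rw [two_nsmul]
    exact le_add_of_nonneg_left ha
  exact this.trans (by simpa using norm_nsmul_le (n := 2) (a := a))

/-- A positive operator of finite rank is a norm limit of sums of positive operators of rank
one. -/
theorem exists_positive_approx {B : X →L[ℝ] Y} (hfin : B.IsFiniteRank) (hB : B.IsPositiveOp)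
    {ε : ℝ} (hε : 0 < ε) :
    ∃ (ι : Type) (_ : Fintype ι) (f : ι → StrongDual ℝ X) (y : ι → Y), (∀ i, 0 ≤ f i) ∧
      (∀ i, 0 ≤ y i) ∧ (∀ i, y i ≠ 0) ∧ ‖B - ∑ i, (f i).smulRight (y i)‖ ≤ ε := by
  classical
  obtain ⟨n, β, x, hβ⟩ := hfin.exists_eq_sum_apply
  set e : Y := ∑ k, |B (x k)| with he
  have he0 : 0 ≤ e := Finset.sum_nonneg fun k _ => abs_nonneg _
  have hke : ∀ k, |B (x k)| ≤ e := fun k =>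
    Finset.single_le_sum (f := fun k => |B (x k)|) (fun k _ => abs_nonneg _) (Finset.mem_univ k)
  -- With mesh `a = e / M` the final error is `(∑ ‖β k‖) * 2‖e‖ / M`; the summand `1` ensures `M >
  -- 0`.
  obtain ⟨M, hM⟩ := exists_nat_ge ((∑ k, ‖β k‖) * (2 * ‖e‖) / ε + 1)
  have hMpos : (0 : ℝ) < M := lt_of_lt_of_le (by positivity) hM
  have hM1 : 1 ≤ M := by exact_mod_cast hMpos
  set a : Y := (M : ℝ)⁻¹ • e with ha
  have ha0 : 0 ≤ a := smul_nonneg (by positivity) he0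
  have hMa' : (M : ℝ) • a = e := by rw [ha, smul_smul, mul_inv_cancel₀ hMpos.ne', one_smul]
  have hMa : M • a = e := by rw [← Nat.cast_smul_eq_nsmul ℝ, hMa']
  have hae : a ≤ e := by
    rw [← hMa]
    calc a = 1 • a := (one_nsmul a).symm
      _ ≤ M • a := nsmul_le_nsmul_left ha0 hM1
  have hup : ∀ k, B (x k) ≤ e := fun k => (le_abs_self _).trans (hke k)
  have hlo : ∀ k, -e ≤ B (x k) := fun k => neg_le.1 ((neg_le_abs _).trans (hke k))
  -- The shift by `2e` puts the elements between `e ≥ a` and `3e = 3M • a`, as the partition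
  -- requires.
  obtain ⟨ι, _, b, K, hb, hs, hK⟩ := exists_partition (fun k => B (x k) + (e + e)) (N := 3 * M) ha0
    (fun k => by
      have := add_le_add (hlo k) (le_refl (e + e))
      rw [neg_add_cancel_left] at this
      exact hae.trans this)
    (fun k => by
      rw [mul_nsmul', hMa]
      calc B (x k) + (e + e) ≤ e + (e + e) := add_le_add (hup k) le_rfl
        _ = 3 • e := by rw [show 3 = 1 + 2 from rfl, add_nsmul, one_nsmul, two_nsmul])
    Finset.univ
  have hba : ∀ j, b j ≤ a := fun j =>
    hs ▸ Finset.single_le_sum (fun j _ => hb j) (Finset.mem_univ j)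
  choose f hf0 hfβ hft using fun j => exists_positive_functional hB hβ
    (fun k => (hup k).trans_eq hMa'.symm) (fun k => (congrArg Neg.neg hMa').trans_le (hlo k))
    (hb j) (hba j)
  -- On the part `b j`, both the shifted `B (x k)` and the shifted value `f j (x k)` have levels
  -- between `K k j` and `K k j + 2`. Combined with the bounds on `∑ K k j • b j`, this puts the
  -- difference in `[-2a, a]`.
  have hd : ∀ k, ‖B (x k) - ∑ j, f j (x k) • b j‖ ≤ 2 * ‖a‖ := by
    intro k
    obtain ⟨h1, h2, h3, h4⟩ := hK k (Finset.mem_univ k)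
    have hee : e + e = (2 * M : ℝ) • a := by rw [mul_smul, hMa', two_smul]
    have hsum : ∑ j, (f j (x k) + 2 * M) • b j = ∑ j, f j (x k) • b j + (e + e) := by
      simp only [add_smul, Finset.sum_add_distrib]
      rw [← Finset.smul_sum, hs, hee]
    have hrw : B (x k) - ∑ j, f j (x k) • b j =
        B (x k) + (e + e) - ∑ j, (f j (x k) + 2 * M) • b j := by
      rw [hsum]
      abel
    have hlow : ∑ j, K k j • b j ≤ ∑ j, (f j (x k) + 2 * M) • b j := by
      refine Finset.sum_le_sum fun j _ => ?_
      by_cases hj : b j = 0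
      · simp [hj]
      rw [← Nat.cast_smul_eq_nsmul ℝ]
      refine smul_le_smul_of_nonneg_right ?_ (hb j)
      have := hft j hj (-(x k)) (-(K k j - 2 * M)) (by
        rw [inf_comm]
        convert h1 j using 3
        rw [hee, map_neg, neg_smul, sub_smul, Nat.cast_smul_eq_nsmul]
        abel)
      rw [map_neg] at this
      linarith
    have hupp : ∑ j, (f j (x k) + 2 * M) • b j ≤ ∑ j, K k j • b j + 2 • a := by
      rw [← hs, Finset.smul_sum, ← Finset.sum_add_distrib]
      refine Finset.sum_le_sum fun j _ => ?_
      by_cases hj : b j = 0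
      · simp [hj]
      rw [← add_nsmul, ← Nat.cast_smul_eq_nsmul ℝ]
      refine smul_le_smul_of_nonneg_right ?_ (hb j)
      have := hft j hj (x k) ((K k j + 2 : ℕ) - 2 * M) (by
        rw [inf_comm]
        convert h2 j using 3
        rw [hee, sub_smul, Nat.cast_smul_eq_nsmul]
        abel)
      linarith
    rw [hrw]
    refine norm_le_two_mul_of_mem ?_ ?_ ha0
    · rw [neg_le_sub_iff_le_add]
      exact hupp.trans (by rw [add_comm, add_comm _ (2 • a)]; exact add_le_add le_rfl h4)
    · rw [sub_le_comm]
      exact h3.trans hlow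
  refine ⟨{j // b j ≠ 0}, inferInstance, fun j => f j, fun j => b j, fun j => hf0 j, fun j => hb j,
    fun j => j.2, ?_⟩
  have hsub : ∑ j : {j // b j ≠ 0}, (f j).smulRight (b j) = ∑ j, (f j).smulRight (b j) := by
    rw [← Fintype.sum_subtype_add_sum_subtype (fun j => b j ≠ 0)
      fun j => (f j).smulRight (b j), left_eq_add]
    refine Finset.sum_eq_zero fun j _ => ?_
    rw [not_not.1 j.2]
    ext
    simp
  -- Since `B` and all `f j` are determined by their values at the `x k`, errors at these finitely
  -- many points control the operator norm.
  have hBsub : B - ∑ j, (f j).smulRight (b j) =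
      ∑ k, (β k).smulRight (B (x k) - ∑ j, f j (x k) • b j) := by
    ext y
    simp only [_root_.sub_apply, _root_.sum_apply, ContinuousLinearMap.smulRight_apply, smul_sub,
      Finset.sum_sub_distrib]
    rw [← hβ]
    congr 1
    simp only [Finset.smul_sum, smul_smul]
    rw [Finset.sum_comm]
    refine Finset.sum_congr rfl fun j _ => ?_
    rw [← Finset.sum_smul, ← hfβ]
  rw [hsub, hBsub]
  calc ‖∑ k, (β k).smulRight (B (x k) - ∑ j, f j (x k) • b j)‖
      ≤ ∑ k, ‖β k‖ * (2 * ‖a‖) := by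
        refine (norm_sum_le _ _).trans (Finset.sum_le_sum fun k _ => ?_)
        rw [ContinuousLinearMap.norm_smulRight_apply]
        exact mul_le_mul_of_nonneg_left (hd k) (norm_nonneg _)
    _ = (∑ k, ‖β k‖) * (2 * ‖e‖) / M := by
        rw [← Finset.sum_mul, ha, norm_smul, norm_inv, Real.norm_of_nonneg hMpos.le]
        ring
    _ ≤ ε := by
        rw [div_le_iff₀ hMpos, ← div_le_iff₀' hε]
        linarith

end PositiveApprox

/-! ### Finite dimensional Banach lattices -/

/-- A family of nonzero positive elements. -/
structure PosFamily (ι Y : Type*) [Zero Y] [LE Y] where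
  /-- The members of the family. -/
  val : ι → Y
  nonneg : ∀ i, 0 ≤ val i
  ne_zero : ∀ i, val i ≠ 0

/-- The coordinate lattice `ℝ^ι` with the norm `‖∑ |aᵢ| yᵢ‖`. -/
def FinLattice {ι Y : Type*} [Zero Y] [LE Y] (_y : PosFamily ι Y) : Type _ := ι → ℝ

namespace FinLattice

variable {ι : Type*} [Fintype ι] {Y : Type*} [NormedAddCommGroup Y] [NormedSpace ℝ Y] [Lattice Y]
  [IsBanachLattice Y] {y : PosFamily ι Y}

noncomputable instance : Lattice (FinLattice y) := inferInstanceAs (Lattice (ι → ℝ))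

theorem norm_sum_smul_le_of_abs_le {c : ι → ℝ} {d : ι → ℝ} (h : ∀ i, |c i| ≤ d i) :
    ‖∑ i, c i • y.val i‖ ≤ ‖∑ i, d i • y.val i‖ := by
  have h1 : ∀ i, |c i • y.val i| ≤ d i • y.val i := fun i => by
    rw [abs_le']
    refine ⟨smul_le_smul_of_nonneg_right ((le_abs_self _).trans (h i)) (y.nonneg i), ?_⟩
    rw [← neg_smul]
    exact smul_le_smul_of_nonneg_right ((neg_le_abs _).trans (h i)) (y.nonneg i)
  refine norm_le_norm_of_abs_le_abs ?_
  rw [abs_of_nonneg (a := ∑ i, d i • y.val i) (Finset.sum_nonneg fun i _ =>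
    (abs_nonneg (c i • y.val i)).trans (h1 i))]
  rw [abs_le', ← Finset.sum_neg_distrib]
  exact ⟨Finset.sum_le_sum fun i _ => (le_abs_self _).trans (h1 i),
    Finset.sum_le_sum fun i _ => (neg_le_abs _).trans (h1 i)⟩

/-- The norm `‖∑ |aᵢ| yᵢ‖`. -/
noncomputable def groupNorm (y : PosFamily ι Y) : AddGroupNorm (ι → ℝ) where
  toFun a := ‖∑ i, |a i| • y.val i‖
  map_zero' := by simp
  add_le' a b := by
    refine le_trans ?_ (norm_add_le _ _)
    rw [← Finset.sum_add_distrib]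
    simp only [← add_smul]
    exact norm_sum_smul_le_of_abs_le fun i => by
      rw [abs_abs]
      exact abs_add_le _ _
  neg' a := by simp
  -- A sum of positive elements vanishes only termwise; the norm is definite because no member of
  -- the family is zero.
  eq_zero_of_map_eq_zero' a ha := by
    rw [norm_eq_zero, Finset.sum_eq_zero_iff_of_nonneg
      fun i _ => smul_nonneg (abs_nonneg _) (y.nonneg i)] at ha
    ext i
    simpa [y.ne_zero i] using ha i (Finset.mem_univ i)

noncomputable instance : NormedAddCommGroup (FinLattice y) :=
  (groupNorm y).toNormedAddCommGroup

noncomputable instance : NormedSpace ℝ (FinLattice y) :=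
  letI : Module ℝ (FinLattice y) := inferInstanceAs (Module ℝ (ι → ℝ))
  { toModule := inferInstance
    norm_smul_le := fun t a => by
      change ‖∑ i, |t * (show ι → ℝ from a) i| • y.val i‖ ≤
        ‖t‖ * ‖∑ i, |(show ι → ℝ from a) i| • y.val i‖
      rw [← norm_smul_of_nonneg (norm_nonneg t), Finset.smul_sum]
      simp only [smul_smul, abs_mul, Real.norm_eq_abs, le_refl] }

/-- The coordinates. -/
def equivFun (y : PosFamily ι Y) : FinLattice y ≃ₗ[ℝ] (ι → ℝ) where
  toFun a := a
  invFun a := a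
  map_add' _ _ := rfl
  map_smul' _ _ := rfl

/-- The coordinate basis. -/
noncomputable def basis (y : PosFamily ι Y) : Module.Basis ι ℝ (FinLattice y) :=
  .ofEquivFun (equivFun y)

theorem basis_coord (a : FinLattice y) (i : ι) : (basis y).coord i a = equivFun y a i := by
  simp [basis]

theorem norm_def (a : FinLattice y) : ‖a‖ = ‖∑ i, |equivFun y a i| • y.val i‖ := rfl

instance : FiniteDimensional ℝ (FinLattice y) := (basis y).finiteDimensional_of_finite

instance : IsBanachLattice (FinLattice y) where
  toCompleteSpace := FiniteDimensional.complete ℝ _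
  add_le_add_left a b h c i := add_le_add_left (h i) ((show ι → ℝ from c) i)
  smul_le_smul_of_nonneg_left a ha b c h i := mul_le_mul_of_nonneg_left (h i) ha
  smul_le_smul_of_nonneg_right f hf a b h i := mul_le_mul_of_nonneg_right h (hf i)
  solid a b h := by
    rw [norm_def, norm_def]
    exact norm_sum_smul_le_of_abs_le fun i => by
      rw [abs_abs]
      exact h i

theorem basis_nonneg (i : ι) : 0 ≤ basis y i := by
  classical
  intro j
  change (0 : ℝ) ≤ equivFun y (basis y i) j
  rw [← basis_coord, Module.Basis.coord_apply, Module.Basis.repr_self, Finsupp.single_apply]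
  split_ifs <;> norm_num

theorem coord_nonneg {a : FinLattice y} (ha : 0 ≤ a) (i : ι) : 0 ≤ (basis y).coord i a := by
  rw [basis_coord]
  exact ha i

/-- The canonical operator `a ↦ ∑ aᵢ yᵢ`. -/
noncomputable def toLattice (y : PosFamily ι Y) : FinLattice y →L[ℝ] Y :=
  LinearMap.toContinuousLinearMap (∑ i, ((basis y).coord i).smulRight (y.val i))

theorem toLattice_apply (a : FinLattice y) :
    toLattice y a = ∑ i, (basis y).coord i a • y.val i := by
  simp [toLattice]

theorem toLattice_basis (i : ι) : toLattice y (basis y i) = y.val i := by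
  classical
  rw [toLattice_apply, Finset.sum_eq_single i]
  · simp
  · intro j _ hj
    simp [hj.symm]
  · simp

theorem toLattice_sum_smul_basis (t : ι → ℝ) :
    toLattice y (∑ i, t i • basis y i) = ∑ i, t i • y.val i := by
  simp only [map_sum, map_smul, toLattice_basis]

theorem norm_toLattice_le : ‖toLattice y‖ ≤ 1 :=
  ContinuousLinearMap.opNorm_le_bound _ zero_le_one fun a => by
    rw [one_mul, norm_def, toLattice_apply]
    simp only [basis_coord]
    exact norm_sum_smul_le_of_abs_le fun i => le_rfl

theorem toLattice_nonneg {a : FinLattice y} (ha : 0 ≤ a) : 0 ≤ toLattice y a := by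
  rw [toLattice_apply]
  exact Finset.sum_nonneg fun i _ => smul_nonneg (coord_nonneg ha i) (y.nonneg i)

variable {X : Type*} [NormedAddCommGroup X] [NormedSpace ℝ X] [Lattice X] [IsBanachLattice X]

/-- The operator `x ↦ (fᵢ x)ᵢ`. -/
noncomputable def lift (y : PosFamily ι Y) (f : ι → StrongDual ℝ X) : X →L[ℝ] FinLattice y :=
  ∑ i, (f i).smulRight (basis y i)

theorem lift_apply (f : ι → StrongDual ℝ X) (x : X) :
    lift y f x = ∑ i, f i x • basis y i := by
  simp [lift]

theorem coord_lift (f : ι → StrongDual ℝ X) (x : X) (i : ι) :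
    (basis y).coord i (lift y f x) = f i x := by
  classical
  rw [lift_apply, map_sum]
  simp only [map_smul, Module.Basis.coord_apply, Module.Basis.repr_self, smul_eq_mul]
  simp [Finsupp.single_apply]

/-- Positivity gives `|fᵢ x| ≤ fᵢ |x|`, so the norm of the image of `x` is at most `‖∑ fᵢ |x| yᵢ‖`.
The norm of `FinLattice` is chosen for this estimate. -/
theorem norm_lift_le {f : ι → StrongDual ℝ X} (hf : ∀ i, 0 ≤ f i) :
    ‖lift y f‖ ≤ ‖∑ i, (f i).smulRight (y.val i)‖ := by
  refine ContinuousLinearMap.opNorm_le_bound _ (norm_nonneg _) fun x => ?_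
  have h := (∑ i, (f i).smulRight (y.val i)).le_opNorm |x|
  rw [norm_abs_eq_norm] at h
  refine le_trans ?_ h
  rw [norm_def]
  simp only [_root_.sum_apply, ContinuousLinearMap.smulRight_apply]
  refine norm_sum_smul_le_of_abs_le fun i => ?_
  rw [abs_abs, ← basis_coord, coord_lift]
  have h1 := hf i x⁺ (posPart_nonneg x)
  have h2 := hf i x⁻ (negPart_nonneg x)
  rw [_root_.zero_apply] at h1 h2
  rw [← posPart_add_negPart x, map_add]
  conv_lhs => rw [← posPart_sub_negPart x, map_sub]
  rw [abs_le]
  constructor <;> linarith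

theorem lift_isPositiveOp {f : ι → StrongDual ℝ X} (hf : ∀ i, 0 ≤ f i) :
    (lift y f).IsPositiveOp := fun x hx => by
  rw [lift_apply]
  exact Finset.sum_nonneg fun i _ => smul_nonneg (hf i x hx) (basis_nonneg i)

theorem toLattice_comp_lift (f : ι → StrongDual ℝ X) :
    (toLattice y).comp (lift y f) = ∑ i, (f i).smulRight (y.val i) := by
  ext x
  simp only [ContinuousLinearMap.comp_apply, toLattice_apply, coord_lift, _root_.sum_apply,
    ContinuousLinearMap.smulRight_apply]

end FinLattice

section DualSpaces

set_option maxSynthPendingDepth 3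

/-! ### Transposition through a finite dimensional space -/

section Transpose

variable {G : Type*} [NormedAddCommGroup G] [NormedSpace ℝ G] [FiniteDimensional ℝ G]
  {ι : Type*} [Fintype ι] {U : Type*} [NormedAddCommGroup U] [NormedSpace ℝ U]

/-- The dual basis, as continuous functionals. -/
noncomputable def dualCoord (c : Module.Basis ι ℝ G) (i : ι) : StrongDual ℝ G :=
  (c.coord i).toContinuousLinearMap

theorem dualCoord_apply (c : Module.Basis ι ℝ G) (i : ι) (y : G) :
    dualCoord c i y = c.coord i y := rfl

/-- The canonical map `G** → G` of a finite dimensional space. -/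
noncomputable def ofBidual (c : Module.Basis ι ℝ G) : StrongDual ℝ (StrongDual ℝ G) →L[ℝ] G :=
  evalSum (dualCoord c) c

theorem dual_eq_sum_smul_dualCoord (c : Module.Basis ι ℝ G) (f : StrongDual ℝ G) :
    f = ∑ i, f (c i) • dualCoord c i := by
  ext y
  rw [dual_eq_sum_coord c f y]
  simp [dualCoord_apply]

/-- `ofBidual` inverts the canonical embedding: `f (ofBidual c ξ) = ξ f` for all `f`. -/
theorem norm_ofBidual_le (c : Module.Basis ι ℝ G) : ‖ofBidual c‖ ≤ 1 := by
  refine ContinuousLinearMap.opNorm_le_bound _ zero_le_one fun ξ => ?_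
  rw [one_mul]
  refine NormedSpace.norm_le_dual_bound ℝ _ (norm_nonneg _) fun f => ?_
  have h : f (ofBidual c ξ) = ξ f := by
    conv_rhs => rw [dual_eq_sum_smul_dualCoord c f]
    simp [ofBidual, mul_comm]
  rw [h]
  exact ξ.le_opNorm f

/-- The operator `U → G` with transpose `V : G* → U*`. -/
noncomputable def transposeSum (c : Module.Basis ι ℝ G) :
    (StrongDual ℝ G →L[ℝ] StrongDual ℝ U) →L[ℝ] (U →L[ℝ] G) :=
  ∑ i, ((ContinuousLinearMap.smulRightL ℝ U G).flip (c i)).comp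
    (ContinuousLinearMap.apply ℝ (StrongDual ℝ U) (dualCoord c i))

theorem transposeSum_apply (c : Module.Basis ι ℝ G) (V : StrongDual ℝ G →L[ℝ] StrongDual ℝ U)
    (z : U) : transposeSum c V z = ∑ i, V (dualCoord c i) z • c i := by
  simp [transposeSum]

/-- Swapping the factors turns a representation for one kind of nuclear norm into one for the other.
-/
theorem transposeSum_smulRight (c : Module.Basis ι ℝ G) (ξ : StrongDual ℝ (StrongDual ℝ G))
    (η : StrongDual ℝ U) :
    transposeSum c (ξ.smulRight η) = η.smulRight (ofBidual c ξ) := by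
  ext z
  rw [transposeSum_apply]
  simp [ofBidual, Finset.smul_sum, smul_smul, mul_comm]

theorem evalSum_dualCoord {Z : Type*} [NormedAddCommGroup Z] [NormedSpace ℝ Z]
    (c : Module.Basis ι ℝ G) (g : ι → Z) (i : ι) : evalSum c g (dualCoord c i) = g i := by
  classical
  rw [evalSum_apply, Finset.sum_eq_single i]
  · simp [dualCoord_apply]
  · intro j _ hj
    simp [dualCoord_apply, hj]
  · simp

end Transpose

/-! ### Behaviour of nuclear norms under maps -/

section Transfer

variable {U Z O U' Z' O' : Type*} [NormedAddCommGroup U] [NormedSpace ℝ U]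
  [NormedAddCommGroup Z] [NormedSpace ℝ Z] [Lattice Z] [IsBanachLattice Z]
  [NormedAddCommGroup O] [NormedSpace ℝ O]
  [NormedAddCommGroup U'] [NormedSpace ℝ U']
  [NormedAddCommGroup Z'] [NormedSpace ℝ Z'] [Lattice Z'] [IsBanachLattice Z']
  [NormedAddCommGroup O'] [NormedSpace ℝ O']

theorem nucNorm_map_le {β : U →L[ℝ] Z →L[ℝ] O} {β' : U' →L[ℝ] Z' →L[ℝ] O'} {p : ℝ≥0∞}
    (hp : 1 ≤ p) (Φ : O →L[ℝ] O') (A : U →L[ℝ] U') (P : Z →L[ℝ] Z') (hA : ‖A‖ ≤ 1)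
    (hP : ‖P‖ ≤ 1) (hpos : P.IsPositiveOp) (h : ∀ u z, Φ (β u z) = β' (A u) (P z)) (V : O) :
    nucNorm β' p (Φ V) ≤ nucNorm β p V := by
  refine le_iInf fun u => le_iInf fun x => le_iInf fun hr => ?_
  have h1 : seqNorm p (fun n => A (u n)) ≤ seqNorm p u :=
    (seqNorm_map_le hp A u).trans
      (mul_le_of_le_one_left (by positivity) (enorm_le_one_of_norm_le_one hA))
  have h2 : weakSeqNorm p.conjExponent (fun n => P (x n)) ≤ weakSeqNorm p.conjExponent x :=
    (weakSeqNorm_map_le (one_le_conjExponent p) P x).trans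
      (mul_le_of_le_one_left (by positivity) (enorm_le_one_of_norm_le_one hP))
  refine (nucNorm_le (u := fun n => A (u n)) (x := fun n => P (x n))
    ⟨h1.trans_lt hr.left, h2.trans_lt hr.right, fun j => hpos _ (hr.nonneg j), ?_⟩).trans
    (mul_le_mul' h1 h2)
  simpa only [Function.comp_def, h] using hr.hasSum.map Φ Φ.continuous

theorem mul_enorm_mul_enorm_le {E F E' F' : Type*} [NormedAddCommGroup E] [NormedAddCommGroup F]
    [NormedAddCommGroup E'] [NormedAddCommGroup F'] {C ε : ℝ≥0} {a : E} {b : F} {a' : E'} {b' : F'}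
    (h : C * ‖a‖ * ‖b‖ ≤ C * ‖a'‖ * ‖b'‖ + ε) :
    (C : ℝ≥0∞) * ‖a‖ₑ * ‖b‖ₑ ≤ C * ‖a'‖ₑ * ‖b'‖ₑ + ε := by
  simp only [← ofReal_norm]
  have hC : (C : ℝ≥0∞) = ENNReal.ofReal C := ENNReal.ofReal_coe_nnreal.symm
  have hε : (ε : ℝ≥0∞) = ENNReal.ofReal ε := ENNReal.ofReal_coe_nnreal.symm
  rw [hC, hε, ← ENNReal.ofReal_mul (by positivity), ← ENNReal.ofReal_mul (by positivity),
    ← ENNReal.ofReal_mul (by positivity), ← ENNReal.ofReal_mul (by positivity),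
    ← ENNReal.ofReal_add (by positivity) (by positivity)]
  exact ENNReal.ofReal_le_ofReal h

end Transfer

/-! ### From the operator to its adjoint -/

section Main

variable {E : Type u} [NormedAddCommGroup E] [NormedSpace ℝ E]
  {X : Type v} [NormedAddCommGroup X] [NormedSpace ℝ X] [Lattice X] [IsBanachLattice X]
  {p : ℝ≥0∞} {S : E →L[ℝ] X} {C : ℝ≥0}

open ContinuousLinearMap

/-- If `R` were the transpose of an operator into `E`, then `R S* A` would be the transpose of a
test composition for `S`, with `A.flip : X → Y*` on the left. Local reflexivity supplies `evalSum c
g : G* → E` whose transpose imitates `R` on the finitely many vectors `S* (x k)`. -/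
theorem IsLatIntegralBound.dualAdjoint (hp : 1 ≤ p) (hC : IsLatIntegralBound p S C) :
    IsPosIntegralBound p S.dualAdjoint C := by
  intro Y _ _ _ _ F _ _ _ A R hA hAp hR
  rw [posNuclearNorm_eq]
  refine nucNorm_le_of_forall_exists hp fun ε hε => ?_
  obtain ⟨n, a, x, hAx⟩ := hA.exists_eq_sum
  have : FiniteDimensional ℝ (LinearMap.range (R : StrongDual ℝ E →ₗ[ℝ] F)) := hR
  let G := LinearMap.range (R : StrongDual ℝ E →ₗ[ℝ] F)
  let R₁ : StrongDual ℝ E →L[ℝ] G :=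
    R.codRestrict _ fun f => LinearMap.mem_range_self (R : StrongDual ℝ E →ₗ[ℝ] F) f
  have hR₁ : ‖R₁‖ ≤ ‖R‖ := R₁.opNorm_le_bound (norm_nonneg R) fun f => R.le_opNorm f
  let c := Module.finBasis ℝ G
  have hε' : (0 : ℝ) < ε := hε
  -- No positivity is needed on `E`: with the whole space as cone, only `χ = 0` is nonnegative on it
  -- and the bipolar condition is void. The summands `1` below keep the denominators positive.
  obtain ⟨g, -, hgn, hg⟩ := exists_localReflexivity c R₁ ⊤ trivial
    (fun i χ hχ => by
      have : χ = 0 := by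
        ext q
        have h1 := hχ q trivial
        have h2 := hχ (-q) trivial
        rw [map_neg] at h2
        exact le_antisymm (neg_nonneg.1 h2) h1
      simp [this])
    (fun k => S.dualAdjoint (x k)) (δ := ε / (C * ‖A‖ + 1))
    (ε := ε / ((∑ i, ‖c i‖) * (∑ k, ‖a k‖) + 1)) (by positivity) (by positivity)
  have hflip : ∀ y z, A.flip z y = A y z := fun _ _ => rfl
  have hbound := hC (StrongDual ℝ G) (StrongDual ℝ Y) (evalSum c g) A.flip
    (isFiniteRank_of_finiteDimensional_left _) hA.flip (fun z hz y hy => hAp y hy z hz)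
  rw [latNuclearNorm_eq] at hbound
  refine ⟨G.subtypeL.comp (transposeSum c (A.flip.comp (S.comp (evalSum c g)))), ?_, n,
    fun k => R (S.dualAdjoint (x k)) - ∑ i, S.dualAdjoint (x k) (g i) • (c i : F), a, ?_, ?_⟩
  · refine (nucNorm_map_le hp
      ((compL ℝ Y G F G.subtypeL).comp (transposeSum c)) (G.subtypeL.comp (ofBidual c))
      (.id ℝ (StrongDual ℝ Y)) ?_ ?_ (fun z hz => hz) (fun ξ η => ?_)
      (A.flip.comp (S.comp (evalSum c g)))).trans (hbound.trans ?_)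
    · exact (opNorm_comp_le _ _).trans (mul_le_one₀ (Submodule.norm_subtypeL_le G)
        (norm_nonneg _) (norm_ofBidual_le c))
    · exact norm_id_le
    · ext z
      change ((transposeSum c (ξ.smulRight η)) z : F) = _
      rw [transposeSum_smulRight]
      rfl
    · refine mul_enorm_mul_enorm_le ?_
      rw [opNorm_flip]
      have h1 : C * ‖A‖ * (ε / (C * ‖A‖ + 1)) ≤ ε := by
        rw [← mul_div_assoc, div_le_iff₀ (by positivity)]
        nlinarith [mul_nonneg C.coe_nonneg (norm_nonneg A)]
      calc C * ‖evalSum c g‖ * ‖A‖ ≤ C * (‖R‖ + ε / (C * ‖A‖ + 1)) * ‖A‖ := by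
            gcongr
            exact hgn.trans (add_le_add hR₁ le_rfl)
        _ = C * ‖R‖ * ‖A‖ + C * ‖A‖ * (ε / (C * ‖A‖ + 1)) := by ring
        _ ≤ _ := add_le_add le_rfl h1
  · ext y
    have hAy : A y = ∑ k, a k y • x k := by
      conv_lhs => rw [hAx]
      simp
    have e1 : ((transposeSum c (A.flip.comp (S.comp (evalSum c g)))) y : F) =
        ∑ k, a k y • ∑ i, S.dualAdjoint (x k) (g i) • (c i : F) := by
      rw [transposeSum_apply]
      simp only [ContinuousLinearMap.comp_apply, evalSum_dualCoord, hflip, hAy, Submodule.coe_sum,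
        Submodule.coe_smul, dualAdjoint_apply, _root_.sum_apply, _root_.smul_apply, Finset.sum_smul,
        Finset.smul_sum, smul_smul, smul_eq_mul]
      exact Finset.sum_comm
    have e2 : R (S.dualAdjoint (A y)) = ∑ k, a k y • R (S.dualAdjoint (x k)) := by
      rw [hAy, map_sum, map_sum]
      simp only [map_smul]
    simp only [ContinuousLinearMap.comp_apply, _root_.add_apply, _root_.sum_apply, flip_apply,
      smulRightL_apply_apply, Submodule.subtypeL_apply]
    rw [e1, e2]
    simp only [smulRight_apply, ← Finset.sum_add_distrib, ← smul_add, add_sub_cancel]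
  · have hd : ∀ k, ‖R (S.dualAdjoint (x k)) - ∑ i, S.dualAdjoint (x k) (g i) • (c i : F)‖ ≤
        ε / ((∑ i, ‖c i‖) * (∑ k, ‖a k‖) + 1) * ∑ i, ‖c i‖ := by
      intro k
      have e1 : R (S.dualAdjoint (x k)) = ∑ i, c.coord i (R₁ (S.dualAdjoint (x k))) • (c i : F) := by
        have := congrArg Subtype.val (c.sum_repr (R₁ (S.dualAdjoint (x k))))
        simp only [Submodule.coe_sum, Submodule.coe_smul] at this
        exact this.symm
      rw [e1, ← Finset.sum_sub_distrib, Finset.mul_sum]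
      refine (norm_sum_le _ _).trans (Finset.sum_le_sum fun i _ => ?_)
      rw [← sub_smul, norm_smul, Real.norm_eq_abs, abs_sub_comm]
      exact mul_le_mul_of_nonneg_right (hg k i).le (norm_nonneg (c i))
    calc ∑ k, ‖R (S.dualAdjoint (x k)) - ∑ i, S.dualAdjoint (x k) (g i) • (c i : F)‖ * ‖a k‖
        ≤ ∑ k, (ε / ((∑ i, ‖c i‖) * (∑ k, ‖a k‖) + 1) * ∑ i, ‖c i‖) * ‖a k‖ :=
          Finset.sum_le_sum fun k _ => mul_le_mul_of_nonneg_right (hd k) (norm_nonneg _)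
      _ = ε * ((∑ i, ‖c i‖) * (∑ k, ‖a k‖)) / ((∑ i, ‖c i‖) * (∑ k, ‖a k‖) + 1) := by
          rw [← Finset.mul_sum]
          ring
      _ ≤ ε := by
          rw [div_le_iff₀ (by positivity)]
          nlinarith

end Main

/-! ### From the adjoint to the second adjoint, and back to the operator -/

section Main

variable {E : Type u} [NormedAddCommGroup E] [NormedSpace ℝ E]
  {X : Type v} [NormedAddCommGroup X] [NormedSpace ℝ X] [Lattice X] [IsBanachLattice X]
  {p : ℝ≥0∞} {S : E →L[ℝ] X} {C : ℝ≥0}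

open ContinuousLinearMap

/-- A positive operator of finite rank factors approximately through a finite dimensional Banach
lattice. -/
theorem exists_approx_factorization {X : Type*} [NormedAddCommGroup X] [NormedSpace ℝ X]
    [Lattice X] [IsBanachLattice X] {Y : Type v} [NormedAddCommGroup Y] [NormedSpace ℝ Y]
    [Lattice Y] [IsBanachLattice Y] {B : X →L[ℝ] Y} (hfin : B.IsFiniteRank) (hB : B.IsPositiveOp)
    {ε : ℝ} (hε : 0 < ε) :
    ∃ (ι : Type v) (_ : Fintype ι) (y : PosFamily ι Y) (f : ι → StrongDual ℝ X), (∀ i, 0 ≤ f i) ∧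
      ‖FinLattice.lift y f‖ ≤ ‖B‖ + ε ∧
      ‖B - (FinLattice.toLattice y).comp (FinLattice.lift y f)‖ ≤ ε := by
  obtain ⟨ι, _, f, y, hf, hy, hy0, h⟩ := exists_positive_approx hfin hB hε
  -- The index type is lifted so that the resulting `FinLattice` lives in the universe over which
  -- the test lattices range.
  let y' : PosFamily (ULift.{v} ι) Y := ⟨fun i => y i.down, fun i => hy _, fun i => hy0 _⟩
  have hsum : ∑ i : ULift.{v} ι, (f i.down).smulRight (y'.val i) = ∑ i, (f i).smulRight (y i) :=
    Fintype.sum_equiv Equiv.ulift _ _ fun i => rfl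
  refine ⟨ULift ι, inferInstance, y', fun i => f i.down, fun i => hf _, ?_, ?_⟩
  · refine (FinLattice.norm_lift_le fun i => hf _).trans ?_
    rw [hsum]
    have := norm_sub_le B (B - ∑ i, (f i).smulRight (y i))
    rw [sub_sub_cancel] at this
    linarith
  · rw [FinLattice.toLattice_comp_lift, hsum]
    exact h

theorem FinLattice.dualCoord_nonneg {ι Y : Type*} [Fintype ι] [NormedAddCommGroup Y]
    [NormedSpace ℝ Y] [Lattice Y] [IsBanachLattice Y] (y : PosFamily ι Y) (i : ι) :
    0 ≤ dualCoord (FinLattice.basis y) i := fun _ ha => FinLattice.coord_nonneg ha i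

/-- Post-composition with a positive contraction does not increase the nuclear norm. -/
theorem nucNorm_comp_le {F Z Y : Type*} [NormedAddCommGroup F] [NormedSpace ℝ F]
    [NormedAddCommGroup Z] [NormedSpace ℝ Z] [Lattice Z] [IsBanachLattice Z]
    [NormedAddCommGroup Y] [NormedSpace ℝ Y] [Lattice Y] [IsBanachLattice Y] (hp : 1 ≤ p)
    {Q : Z →L[ℝ] Y} (hQ : ‖Q‖ ≤ 1) (hpos : Q.IsPositiveOp) (V : F →L[ℝ] Z) :
    nucNorm (smulRightL ℝ F Y) p (Q.comp V) ≤ nucNorm (smulRightL ℝ F Z) p V :=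
  nucNorm_map_le hp (compL ℝ F Z Y Q) (.id ℝ _) Q norm_id_le hQ hpos
    (fun u z => by ext; simp) V

/-- `B : X** → Y` is first replaced by a positive operator into a finite dimensional lattice
followed by a positive contraction. Local reflexivity makes the first factor weak* continuous, so it
comes from a positive operator `FinLattice* → X*`, and the hypothesis applies with `A.flip : E* →
F*`. -/
theorem IsPosIntegralBound.dualAdjoint (hp : 1 ≤ p) (hC : IsPosIntegralBound p S.dualAdjoint C) :
    IsLatIntegralBound p S.dualAdjoint.dualAdjoint C := by
  intro F _ _ _ Y _ _ _ _ A B hA hB hBp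
  rw [latNuclearNorm_eq]
  refine nucNorm_le_of_forall_exists hp fun ε hε => ?_
  have hε' : (0 : ℝ) < ε := hε
  obtain ⟨n, a, w, hAw⟩ := hA.exists_eq_sum
  have hAz : ∀ z, A z = ∑ k, a k z • w k := fun z => by
    conv_lhs => rw [hAw]
    simp
  obtain ⟨φ, hφ⟩ : ∃ φ : Fin n → StrongDual ℝ (StrongDual ℝ X),
      ∀ k, φ k = S.dualAdjoint.dualAdjoint (w k) := ⟨_, fun _ => rfl⟩
  obtain ⟨ε₁, hε₁, h1, h2⟩ : ∃ ε₁ : ℝ, 0 < ε₁ ∧ C * ‖A‖ * (2 * ε₁) ≤ ε ∧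
      ε₁ * (∑ k, ‖a k‖ * ‖φ k‖) ≤ ε / 2 := by
    have e1 : 0 ≤ C * ‖A‖ := by positivity
    have e2 : 0 ≤ ∑ k, ‖a k‖ * ‖φ k‖ := Finset.sum_nonneg fun k _ => by positivity
    generalize (C : ℝ) * ‖A‖ = s at *
    generalize ∑ k, ‖a k‖ * ‖φ k‖ = t at *
    refine ⟨ε / (2 * (s + t + 1)), by positivity, ?_, ?_⟩
    · rw [← mul_div_assoc, ← mul_div_assoc, div_le_iff₀ (by positivity)]
      nlinarith
    · rw [div_mul_eq_mul_div, div_le_iff₀ (by positivity)]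
      nlinarith
  obtain ⟨ι, _, y, f, hf, hlift, happ⟩ := exists_approx_factorization hB hBp hε₁
  -- The coordinates `f i` are positive elements of `X***`, hence in the bipolar of the positive
  -- cone of `X*`; this makes the approximants `g i` positive.
  obtain ⟨g, hg0, hgn, hg⟩ := exists_localReflexivity (FinLattice.basis y) (FinLattice.lift y f)
    (ConvexCone.positive ℝ (StrongDual ℝ X)) (le_refl (0 : StrongDual ℝ X))
    (fun i χ hχ => by
      rw [FinLattice.coord_lift]
      exact hf i χ hχ)
    φ hε₁ (ε := ε / (2 * ((∑ i, ‖y.val i‖) * (∑ k, ‖a k‖)) + 1)) (by positivity)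
  simp only [FinLattice.coord_lift] at hg
  have hbound := hC (StrongDual ℝ (FinLattice y)) (StrongDual ℝ F)
    (evalSum (FinLattice.basis y) g) A.flip
    (isFiniteRank_sum (fun i => apply ℝ ℝ (FinLattice.basis y i)) g)
    (fun ξ hξ => by
      rw [evalSum_apply]
      exact Finset.sum_nonneg fun i _ => smul_nonneg (hξ _ (FinLattice.basis_nonneg i)) (hg0 i))
    hA.flip
  rw [posNuclearNorm_eq] at hbound
  refine ⟨(FinLattice.toLattice y).comp (transposeSum (FinLattice.basis y)
    (A.flip.comp (S.dualAdjoint.comp (evalSum (FinLattice.basis y) g)))), ?_, n, a,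
    fun k => B (φ k) - ∑ i, φ k (g i) • y.val i, ?_, ?_⟩
  · refine (nucNorm_comp_le hp FinLattice.norm_toLattice_le
      (fun _ ha => FinLattice.toLattice_nonneg ha) _).trans ?_
    refine (nucNorm_map_le hp (transposeSum (FinLattice.basis y)) (.id ℝ (StrongDual ℝ F))
      (ofBidual (FinLattice.basis y)) norm_id_le (norm_ofBidual_le _) (fun ξ hξ => ?_)
      (fun η ξ => ?_) _).trans (hbound.trans ?_)
    · rw [ofBidual, evalSum_apply]
      exact Finset.sum_nonneg fun i _ =>
        smul_nonneg (hξ _ (FinLattice.dualCoord_nonneg y i)) (FinLattice.basis_nonneg i)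
    · exact transposeSum_smulRight _ ξ η
    · rw [mul_right_comm, mul_right_comm (C : ℝ≥0∞), mul_right_comm (C : ℝ≥0∞),
        mul_right_comm (C : ℝ≥0∞)]
      refine mul_enorm_mul_enorm_le ?_
      rw [opNorm_flip]
      calc C * ‖A‖ * ‖evalSum (FinLattice.basis y) g‖ ≤ C * ‖A‖ * (‖B‖ + ε₁ + ε₁) := by
            gcongr
            exact hgn.trans (add_le_add hlift le_rfl)
        _ = C * ‖A‖ * ‖B‖ + C * ‖A‖ * (2 * ε₁) := by ring
        _ ≤ _ := add_le_add le_rfl h1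
  · ext z
    have e1 : FinLattice.toLattice y (transposeSum (FinLattice.basis y)
        (A.flip.comp (S.dualAdjoint.comp (evalSum (FinLattice.basis y) g))) z) =
        ∑ k, a k z • ∑ i, φ k (g i) • y.val i := by
      have hflip : ∀ x, A.flip x z = A z x := fun _ => rfl
      rw [transposeSum_apply, FinLattice.toLattice_sum_smul_basis]
      simp only [ContinuousLinearMap.comp_apply, evalSum_dualCoord, hflip, hAz, hφ,
        dualAdjoint_apply, _root_.sum_apply, _root_.smul_apply, Finset.sum_smul, Finset.smul_sum,
        smul_smul, smul_eq_mul]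
      exact Finset.sum_comm
    have e2 : B (S.dualAdjoint.dualAdjoint (A z)) = ∑ k, a k z • B (φ k) := by
      rw [hAz, map_sum, map_sum]
      simp only [map_smul, hφ]
    simp only [ContinuousLinearMap.comp_apply, _root_.add_apply, _root_.sum_apply,
      smulRightL_apply_apply]
    rw [e1, e2]
    simp only [smulRight_apply, ← Finset.sum_add_distrib, ← smul_add, add_sub_cancel]
  · set η : ℝ := ε / (2 * ((∑ i, ‖y.val i‖) * (∑ k, ‖a k‖)) + 1) with hη
    have hd : ∀ k, ‖B (φ k) - ∑ i, φ k (g i) • y.val i‖ ≤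
        ε₁ * ‖φ k‖ + η * ∑ i, ‖y.val i‖ := by
      intro k
      have e1 : B (φ k) - ∑ i, φ k (g i) • y.val i =
          (B - (FinLattice.toLattice y).comp (FinLattice.lift y f)) (φ k) +
            ∑ i, (f i (φ k) - φ k (g i)) • y.val i := by
        simp only [FinLattice.toLattice_comp_lift, _root_.sub_apply, _root_.sum_apply,
          smulRight_apply, sub_smul, Finset.sum_sub_distrib]
        abel
      rw [e1]
      refine (norm_add_le _ _).trans (add_le_add ?_ ?_)
      · exact (le_opNorm _ _).trans (mul_le_mul_of_nonneg_right happ (norm_nonneg _))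
      · rw [Finset.mul_sum]
        refine (norm_sum_le _ _).trans (Finset.sum_le_sum fun i _ => ?_)
        rw [norm_smul, Real.norm_eq_abs, abs_sub_comm]
        exact mul_le_mul_of_nonneg_right (hg k i).le (norm_nonneg _)
    calc ∑ k, ‖a k‖ * ‖B (φ k) - ∑ i, φ k (g i) • y.val i‖
        ≤ ∑ k, ‖a k‖ * (ε₁ * ‖φ k‖ + η * ∑ i, ‖y.val i‖) :=
          Finset.sum_le_sum fun k _ => mul_le_mul_of_nonneg_left (hd k) (norm_nonneg _)
      _ = ε₁ * (∑ k, ‖a k‖ * ‖φ k‖) + η * ((∑ i, ‖y.val i‖) * ∑ k, ‖a k‖) := by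
          rw [Finset.sum_congr rfl fun k _ => show _ = ε₁ * (‖a k‖ * ‖φ k‖) +
            (η * ∑ i, ‖y.val i‖) * ‖a k‖ by ring, Finset.sum_add_distrib, ← Finset.mul_sum,
            ← Finset.mul_sum, mul_assoc]
      _ ≤ ε / 2 + ε / 2 := by
          refine add_le_add h2 ?_
          rw [hη, div_mul_eq_mul_div, div_le_iff₀ (by positivity)]
          nlinarith
      _ = ε := add_halves _

/-- The left side is the second adjoint of `lift y f`, with the finite dimensional lattice
identified with its bidual. -/
theorem FinLattice.norm_lift_inclusion_le {ι Y : Type*} [Fintype ι] [NormedAddCommGroup Y]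
    [NormedSpace ℝ Y] [Lattice Y] [IsBanachLattice Y] (y : PosFamily ι Y)
    (f : ι → StrongDual ℝ X) :
    ‖FinLattice.lift y fun i => NormedSpace.inclusionInDoubleDual ℝ (StrongDual ℝ X) (f i)‖ ≤
      ‖FinLattice.lift y f‖ := by
  refine ContinuousLinearMap.opNorm_le_bound _ (norm_nonneg _) fun x => ?_
  refine NormedSpace.norm_le_dual_bound ℝ _ (by positivity) fun ξ => ?_
  have h : ξ (FinLattice.lift y
      (fun i => NormedSpace.inclusionInDoubleDual ℝ (StrongDual ℝ X) (f i)) x) =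
      x (ξ.comp (FinLattice.lift y f)) := by
    have e : ξ.comp (FinLattice.lift y f) = ∑ i, ξ (FinLattice.basis y i) • f i := by
      ext z
      simp [FinLattice.lift_apply, mul_comm]
    rw [e, FinLattice.lift_apply]
    simp [mul_comm]
  rw [h]
  calc ‖x (ξ.comp (FinLattice.lift y f))‖ ≤ ‖x‖ * (‖ξ‖ * ‖FinLattice.lift y f‖) :=
        (x.le_opNorm _).trans
          (mul_le_mul_of_nonneg_left (opNorm_comp_le _ _) (norm_nonneg _))
    _ = _ := by ring

/-- After factoring `B` through a finite dimensional lattice, the first factor extends to `X**` with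
no larger norm, and `A` is followed by the embedding of `E` in `E**`. As `S**` extends `S`, this
test composition for `S**` equals the one for `S`. -/
theorem IsLatIntegralBound.of_dualAdjoint_dualAdjoint (hp : 1 ≤ p)
    (hC : IsLatIntegralBound p S.dualAdjoint.dualAdjoint C) : IsLatIntegralBound p S C := by
  intro F _ _ _ Y _ _ _ _ A B hA hB hBp
  rw [latNuclearNorm_eq]
  refine nucNorm_le_of_forall_exists hp fun ε hε => ?_
  have hε' : (0 : ℝ) < ε := hε
  obtain ⟨n, a, w, hAw⟩ := hA.exists_eq_sum
  have hAz : ∀ z, A z = ∑ k, a k z • w k := fun z => by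
    conv_lhs => rw [hAw]
    simp
  obtain ⟨ε₁, hε₁, h1, h2⟩ : ∃ ε₁ : ℝ, 0 < ε₁ ∧ C * ‖A‖ * ε₁ ≤ ε ∧
      ε₁ * (∑ k, ‖a k‖ * ‖S (w k)‖) ≤ ε := by
    have e1 : 0 ≤ C * ‖A‖ := by positivity
    have e2 : 0 ≤ ∑ k, ‖a k‖ * ‖S (w k)‖ := Finset.sum_nonneg fun k _ => by positivity
    generalize (C : ℝ) * ‖A‖ = s at *
    generalize ∑ k, ‖a k‖ * ‖S (w k)‖ = t at *
    refine ⟨ε / (s + t + 1), by positivity, ?_, ?_⟩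
    · rw [← mul_div_assoc, div_le_iff₀ (by positivity)]
      nlinarith
    · rw [div_mul_eq_mul_div, div_le_iff₀ (by positivity)]
      nlinarith
  obtain ⟨ι, _, y, f, hf, hlift, happ⟩ := exists_approx_factorization hB hBp hε₁
  have hf' : ∀ i, 0 ≤ NormedSpace.inclusionInDoubleDual ℝ (StrongDual ℝ X) (f i) :=
    fun i x hx => hx _ (hf i)
  have hbound := hC F (FinLattice y) ((NormedSpace.inclusionInDoubleDual ℝ E).comp A)
    (FinLattice.lift y fun i => NormedSpace.inclusionInDoubleDual ℝ (StrongDual ℝ X) (f i))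
    (hA.comp_left _) (isFiniteRank_of_finiteDimensional_right _)
    (FinLattice.lift_isPositiveOp hf')
  rw [latNuclearNorm_eq] at hbound
  have hcomp : (FinLattice.lift y fun i =>
      NormedSpace.inclusionInDoubleDual ℝ (StrongDual ℝ X) (f i)).comp
        (S.dualAdjoint.dualAdjoint.comp ((NormedSpace.inclusionInDoubleDual ℝ E).comp A)) =
      (FinLattice.lift y f).comp (S.comp A) := by
    ext z
    simp only [ContinuousLinearMap.comp_apply, FinLattice.lift_apply]
    rfl
  rw [hcomp] at hbound
  refine ⟨(FinLattice.toLattice y).comp ((FinLattice.lift y f).comp (S.comp A)), ?_, n, a,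
    fun k => (B - (FinLattice.toLattice y).comp (FinLattice.lift y f)) (S (w k)), ?_, ?_⟩
  · refine (nucNorm_comp_le hp FinLattice.norm_toLattice_le
      (fun _ ha => FinLattice.toLattice_nonneg ha) _).trans (hbound.trans ?_)
    refine mul_enorm_mul_enorm_le ?_
    have e1 : ‖(NormedSpace.inclusionInDoubleDual ℝ E).comp A‖ ≤ ‖A‖ :=
      (opNorm_comp_le _ _).trans (mul_le_of_le_one_left (norm_nonneg _)
        (NormedSpace.inclusionInDoubleDual_norm_le ℝ E))
    calc _ ≤ C * ‖A‖ * (‖B‖ + ε₁) := by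
          gcongr
          exact (FinLattice.norm_lift_inclusion_le y f).trans hlift
      _ = C * ‖A‖ * ‖B‖ + C * ‖A‖ * ε₁ := by ring
      _ ≤ _ := add_le_add le_rfl h1
  · ext z
    simp only [ContinuousLinearMap.comp_apply, _root_.add_apply, _root_.sum_apply, hAz, map_sum,
      map_smul, smulRightL_apply_apply, smulRight_apply, _root_.sub_apply, smul_sub,
      Finset.sum_sub_distrib, add_sub_cancel]
  · calc _ ≤ ∑ k, ‖a k‖ * (ε₁ * ‖S (w k)‖) := Finset.sum_le_sum fun k _ =>
          mul_le_mul_of_nonneg_left ((le_opNorm _ _).trans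
            (mul_le_mul_of_nonneg_right happ (norm_nonneg _))) (norm_nonneg _)
      _ = ε₁ * (∑ k, ‖a k‖ * ‖S (w k)‖) := by
          rw [Finset.mul_sum]
          exact Finset.sum_congr rfl fun k _ => by ring
      _ ≤ ε := h2

theorem IsPosIntegralBound.mono {T : X →L[ℝ] E} {D : ℝ≥0} (hC : IsPosIntegralBound p T C)
    (h : C ≤ D) : IsPosIntegralBound p T D := by
  intro Y _ _ _ _ F _ _ _ A R hA hAp hR
  refine (hC Y F A R hA hAp hR).trans ?_
  gcongr

/-- Admissible constants can be enlarged, so `C + ε` replaces a constant that might be zero and the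
strict positivity does not affect the infimum. -/
theorem posIntegralNorm_eq_iInf (T : X →L[ℝ] E) :
    posIntegralNorm p T = ⨅ (C : ℝ≥0) (_ : IsPosIntegralBound p T C), (C : ℝ≥0∞) := by
  refine le_antisymm (le_iInf₂ fun C hC => ?_)
    (le_iInf₂ fun C hC => iInf₂_le C hC.2)
  refine ENNReal.le_of_forall_pos_le_add fun ε hε _ => ?_
  rw [← ENNReal.coe_add]
  exact iInf₂_le (C + ε) ⟨by positivity, hC.mono le_self_add⟩

theorem isPosIntegral_iff {T : X →L[ℝ] E} :
    IsPosIntegral p T ↔ ∃ C, IsPosIntegralBound p T C :=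
  ⟨fun ⟨C, _, h⟩ => ⟨C, h⟩, fun ⟨C, h⟩ => ⟨C + 1, by positivity, h.mono le_self_add⟩⟩

end Main

end DualSpaces

/-- The three implications form a cycle with `C` unchanged, so the sets of admissible constants for
`S`, `S*` and `S**` coincide. -/
theorem isLatIntegralBound_iff_dualAdjoint {E : Type u} [NormedAddCommGroup E] [NormedSpace ℝ E]
    {X : Type v} [NormedAddCommGroup X] [NormedSpace ℝ X] [Lattice X] [IsBanachLattice X]
    {p : ℝ≥0∞} (hp : 1 ≤ p) {S : E →L[ℝ] X} {C : ℝ≥0} :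
    IsLatIntegralBound p S C ↔ IsPosIntegralBound p S.dualAdjoint C :=
  ⟨fun h => h.dualAdjoint hp, fun h => .of_dualAdjoint_dualAdjoint hp (h.dualAdjoint hp)⟩

theorem isPosIntegralBound_dualAdjoint_iff {E : Type u} [NormedAddCommGroup E] [NormedSpace ℝ E]
    {X : Type v} [NormedAddCommGroup X] [NormedSpace ℝ X] [Lattice X] [IsBanachLattice X]
    {p : ℝ≥0∞} (hp : 1 ≤ p) {S : E →L[ℝ] X} {C : ℝ≥0} :
    IsPosIntegralBound p S.dualAdjoint C ↔ IsLatIntegralBound p S.dualAdjoint.dualAdjoint C :=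
  ⟨fun h => h.dualAdjoint hp, fun h => (h.of_dualAdjoint_dualAdjoint hp).dualAdjoint hp⟩

theorem corollary1p21
    (p : ℝ≥0∞) (hp : 1 ≤ p)
    {E : Type u} [NormedAddCommGroup E] [NormedSpace ℝ E] [CompleteSpace E]
    {X : Type v} [NormedAddCommGroup X] [NormedSpace ℝ X] [Lattice X] [IsBanachLattice X]
    (hX : HasPMAP (StrongDual ℝ (StrongDual ℝ X)))
    (S : E →L[ℝ] X) :
    List.TFAE
      [IsLatIntegral p S,
        IsPosIntegral p S.dualAdjoint,
        IsLatIntegral p S.dualAdjoint.dualAdjoint] ∧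
    (IsLatIntegral p S →
      latIntegralNorm p S = posIntegralNorm p S.dualAdjoint ∧
      posIntegralNorm p S.dualAdjoint = latIntegralNorm p S.dualAdjoint.dualAdjoint) := by
  have h12 : IsLatIntegral p S ↔ IsPosIntegral p S.dualAdjoint := by
    simp only [isPosIntegral_iff, IsLatIntegral, isLatIntegralBound_iff_dualAdjoint hp]
  have h23 : IsPosIntegral p S.dualAdjoint ↔ IsLatIntegral p S.dualAdjoint.dualAdjoint := by
    simp only [isPosIntegral_iff, IsLatIntegral, isPosIntegralBound_dualAdjoint_iff hp]
  refine ⟨?_, fun _ => ⟨?_, ?_⟩⟩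
  · tfae_have 1 ↔ 2 := h12
    tfae_have 2 ↔ 3 := h23
    tfae_finish
  · simp only [latIntegralNorm, posIntegralNorm_eq_iInf, isLatIntegralBound_iff_dualAdjoint hp]
  · simp only [latIntegralNorm, posIntegralNorm_eq_iInf, isPosIntegralBound_dualAdjoint_iff hp]
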